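/- Let $(W,S)$ be a Coxeter system with length function $\ell$, and let $(\Delta,\delta)$ be a building of type $(W,S)$: a nonempty set $\Delta$ of chambers with a Weyl distance $\delta:\Delta\times\Delta\to W$ satisfying the usual axioms. For $J\subseteq S$ let $W_J=\langle J\rangle$; the $J$-residue of a chamber $x$ is $\{y\in\Delta:\delta(x,y)\in W_J\}$. The simplices of the building are in bijection with its spherical residues (those with $W_J$ finite), and a panel is a simplex whose residue is an $\{s\}$-residue with $s\in S$. For a residue $\mathcal B$ and a chamber $x$, $\operatorname{proj}_{\mathcal B}(x)$ is the unique chamber $y\in\mathcal B$ with $\ell(\delta(x,y))$ minimal, and $\operatorname{proj}_{\mathcal B}(\mathcal A)=\{\operatorname{proj}_{\mathcal B}(x):x\in\mathcal A\}$. An apartment is a subset of $\Delta$ that is $\delta$-isometric to $W$ with the distance $(u,v)\mapsto u^{-1}v$; it contains a simplex if it contains a chamber of the residue of that simplex. A wall of an apartment is the set of those of its simplices that are fixed by a reflection (a conjugate of an element of $S$), and each wall bounds two closed halfspaces of the apartment; a wall separates two simplices of the apartment if neither of its two closed halfspaces contains both. The thickness $q(m)$ of a wall $m$ is the number $q$ such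 that the residue of any panel contained in $m$ has $q+1$ chambers. For simplices $b,a$ put $$q(b,a)=\prod_{m} q(m),$$ where $m$ runs over the walls, of an apartment containing $b$ and $a$, that separate $b$ and $a$. All indices, numbers of elements and thicknesses are understood as cardinal numbers (if the building is locally finite, i.e. all panels have finite thickness, and $S$ is finite, then all of those below are natural numbers). Let a group $G$ act on $\Delta$ such that $\delta(gx,gy)=\delta(x,y)$ for all $g\in G$ and $x,y\in\Delta$ (the action is type-preserving), and such that for all chambers $x,y,x',y'$ with $\delta(x,y)=\delta(x',y')$ there is $g\in G$ with $gx=x'$ and $gy=y'$ (the action is Weyl-transitive). Let $a$ and $b$ be simplices with residues $\mathcal A$ and $\mathcal B$, and let $G_a$ and $G_b$ be their stabilizers. Then there is an apartment containing $b$ and $a$, and, whichever such apartment is used to compute $q(b,a)$, $$|G_b : G_b\cap G_a| = |G_b.\operatorname{proj}_{\mathcal B}(\mathcal A)|\cdot q(b,a),$$ where $G_b.\operatorname{proj}_{\mathcal B}(\mathcal A)$ is the orbit of the set $\operatorname{proj}_{\mathcal B}(\mathcal A)$ under $G_b$, a set of subsets of $\mathcal B$. Moreover $|G_b.\operatorname{proj}_{\mathcal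 B}(\mathcal A)|=1$ if and only if the ordered pair $(b,a)$ is aligned, that is, $\operatorname{proj}_{\mathcal B}(\mathcal A)=\mathcal B$. -/

import Mathlib

open scoped Pointwise

universe uI uW uΔ uG

/-- A building of type `(W, S)`, as a set `Δ` of chambers with a Weyl distance function `δ`.
The Coxeter system `(W, S)` is `cs`, with `S` indexed by `I`. -/
structure WeylBuilding {I W : Type*} [Group W] {M : CoxeterMatrix I} (cs : CoxeterSystem M W)
    (Δ : Type*) where
  nonempty : Nonempty Δ
  δ : Δ → Δ → W
  δ_eq_one_iff : ∀ x y, δ x y = 1 ↔ x = y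
  exists_adj : ∀ x y (s : I), ∃ z, δ y z = cs.simple s ∧ δ x z = δ x y * cs.simple s
  δ_adj : ∀ x y z (s : I), δ y z = cs.simple s →
    δ x z = δ x y * cs.simple s ∨ δ x z = δ x y
  δ_adj_of_length : ∀ x y z (s : I), δ y z = cs.simple s →
    cs.length (δ x y * cs.simple s) = cs.length (δ x y) + 1 → δ x z = δ x y * cs.simple s

namespace WeylBuilding

variable {I W Δ : Type*} [Group W] {M : CoxeterMatrix I} {cs : CoxeterSystem M W}

/-- The standard parabolic subgroup `W_J`. -/
def parabolic (cs : CoxeterSystem M W) (J : Set I) : Subgroup W :=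
  Subgroup.closure (cs.simple '' J)

/-- The `J`-residue of a chamber. -/
def residue (X : WeylBuilding cs Δ) (J : Set I) (x : Δ) : Set Δ :=
  {y | X.δ x y ∈ parabolic cs J}

/-- A simplex of the building, given by its residue: the simplices correspond exactly to the
spherical residues, i.e. the `J`-residues with `W_J` finite. -/
@[ext]
structure Simplex (X : WeylBuilding cs Δ) where
  /-- the residue of the simplex: the set of chambers having it as a face -/
  res : Set Δ
  isSpherical : ∃ J : Set I, Finite (parabolic cs J) ∧ ∃ x, res = X.residue J x

theorem Simplex.res_nonempty {X : WeylBuilding cs Δ} (a : X.Simplex) : a.res.Nonempty := by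
  obtain ⟨J, -, x, hx⟩ := a.isSpherical
  refine ⟨x, ?_⟩
  rw [hx]
  change X.δ x x ∈ parabolic cs J
  rw [(X.δ_eq_one_iff x x).2 rfl]
  exact one_mem _

/-- Projection of a chamber `x` to the residue of `b`: the chamber of that residue at minimal
gallery distance `ℓ(δ(x, y))` from `x`. -/
noncomputable def proj (X : WeylBuilding cs Δ) (b : X.Simplex) (x : Δ) : Δ :=
  Function.argminOn (fun y => cs.length (X.δ x y)) b.res b.res_nonempty

/-- The set `proj_B(A)`, where `A`, `B` are the residues of the simplices `a`, `b`. -/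
noncomputable def projRes (X : WeylBuilding cs Δ) (b a : X.Simplex) : Set Δ :=
  X.proj b '' a.res

/-- The ordered pair `(b, a)` is aligned. -/
def IsAlignedPair (X : WeylBuilding cs Δ) (b a : X.Simplex) : Prop :=
  X.projRes b a = b.res

/-- A panel: a simplex whose residue is an `{s}`-residue. -/
def Simplex.IsPanel {X : WeylBuilding cs Δ} (p : X.Simplex) : Prop :=
  ∃ (s : I) (x : Δ), p.res = X.residue {s} x

/-- The thickness `q` of a panel, whose residue has `q + 1` chambers. -/
noncomputable def Simplex.panelThickness {X : WeylBuilding cs Δ} (p : X.Simplex) : Cardinal :=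
  Cardinal.mk ↥(p.res \ {p.res_nonempty.some})

/-- `f` is a `δ`-isometry from the Coxeter complex onto the set `A` of chambers. -/
def IsChart (X : WeylBuilding cs Δ) (A : Set Δ) (f : W → Δ) : Prop :=
  (∀ u v, X.δ (f u) (f v) = u⁻¹ * v) ∧ Set.range f = A

/-- Apartments: the sets of chambers that are `δ`-isometric to the Coxeter complex. -/
def IsApartment (X : WeylBuilding cs Δ) (A : Set Δ) : Prop :=
  ∃ f : W → Δ, X.IsChart A f

/-- The simplex `a` lies in the apartment `A`: it is a face of some chamber of `A`. -/
def Simplex.LiesIn {X : WeylBuilding cs Δ} (a : X.Simplex) (A : Set Δ) : Prop :=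
  (a.res ∩ A).Nonempty

/-- The wall of the reflection `t` in the apartment with chart `f`, as the set of those simplices
of the apartment that are fixed by the reflection `f w ↦ f (t * w)`. -/
def reflectionWall (X : WeylBuilding cs Δ) (f : W → Δ) (t : W) : Set X.Simplex :=
  {a | a.LiesIn (Set.range f) ∧ ∀ w, f w ∈ a.res → f (t * w) ∈ a.res}

/-- The closed halfspace of the apartment with chart `f` that is spanned by the chambers `f w`
with `w ∈ U`: the set of the faces of these chambers. -/
def halfspace (X : WeylBuilding cs Δ) (f : W → Δ) (U : Set W) : Set X.Simplex :=
  {a | ∃ w ∈ U, f w ∈ a.res}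

/-- The set of elements of `W` on the same side of the wall of `t` as `1`; those on the other
side form the complement. -/
def positiveSide (cs : CoxeterSystem M W) (t : W) : Set W :=
  {w | cs.length w < cs.length (t * w)}

/-- The set of the walls `m` of the apartment `A` that separate the simplices `x` and `y`, i.e.
such that neither of the two (closed) halfspaces bounded by `m` in `A` contains both. -/
def separatingWalls (X : WeylBuilding cs Δ) (A : Set Δ) (x y : X.Simplex) :
    Set (Set X.Simplex) :=
  {m | ∃ (f : W → Δ) (t : W), X.IsChart A f ∧ cs.IsReflection t ∧ m = X.reflectionWall f t ∧
    ¬ (x ∈ X.halfspace f (positiveSide cs t) ∧ y ∈ X.halfspace f (positiveSide cs t)) ∧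
    ¬ (x ∈ X.halfspace f (positiveSide cs t)ᶜ ∧ y ∈ X.halfspace f (positiveSide cs t)ᶜ)}

open Classical in
/-- The thickness of a wall: the thickness of any panel contained in it. -/
noncomputable def wallThickness (X : WeylBuilding cs Δ) (m : Set X.Simplex) : Cardinal :=
  if h : ∃ p ∈ m, p.IsPanel then h.choose.panelThickness else 0

/-- The thickness `q(x, y)` of a pair of simplices, computed in an apartment `A` containing
them. -/
noncomputable def pairThickness (X : WeylBuilding cs Δ) (A : Set Δ) (x y : X.Simplex) :
    Cardinal :=
  Cardinal.prod fun m : X.separatingWalls A x y => X.wallThickness m.1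

/-- `G` acts on the building by type-preserving automorphisms. -/
def IsTypePreserving (X : WeylBuilding cs Δ) (G : Type*) [Group G] [MulAction G Δ] : Prop :=
  ∀ (g : G) (x y : Δ), X.δ (g • x) (g • y) = X.δ x y

/-- The action of `G` is Weyl-transitive. -/
def IsWeylTransitive (X : WeylBuilding cs Δ) (G : Type*) [Group G] [MulAction G Δ] : Prop :=
  ∀ x y x' y' : Δ, X.δ x y = X.δ x' y' → ∃ g : G, g • x = x' ∧ g • y = y'

/-- The stabilizer `G_a` of a simplex, i.e. the setwise stabilizer of its residue. -/
def Simplex.stab {X : WeylBuilding cs Δ} (G : Type*) [Group G] [MulAction G Δ]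
    (a : X.Simplex) : Subgroup G :=
  MulAction.stabilizer G a.res

end WeylBuilding

/-! In an apartment containing both simplices, choose chambers c of 𝓑 and d of 𝓐 at minimal
distance; then w = δ(c,d) is the shortest element of W_J w W_K. The index is the size of the
G_b-orbit of 𝓐. Projection is G_b-equivariant, so this orbit fibres over that of proj_𝓑(𝓐)
(`MulAction.mk_orbit_eq_mul`), and `mk_orbit_res_eq` identifies a fibre with the sphere {d' :
δ(c,d') = w}: each residue in the fibre contains exactly one such d', and Weyl-transitivity reaches
every d' by an element fixing c. Along a reduced word of w the sphere has as many chambers as the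
product of the thicknesses of the letters. The walls separating b and a correspond to the inversions
of w, one per letter and of the same thickness (`pairThickness_eq_mk_sphere`). As G_b is transitive
on 𝓑, the only nonempty G_b-invariant subset of 𝓑 is 𝓑 itself; hence the alignment criterion. The
Coxeter input is strong exchange; apartments come from extending partial isometries. -/

/-! ### Inversions, strong exchange and deletion in Coxeter groups. -/

namespace CoxeterSystem

variable {I W : Type*} [Group W] {M : CoxeterMatrix I} (cs : CoxeterSystem M W)

open Classical in
/-- The action of a simple reflection on signed group elements: conjugation, with a change of
sign exactly at the simple reflection itself. -/
noncomputable def signedConj (i : I) : Function.End (W × ZMod 2) :=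
  fun p => (cs.simple i * p.1 * cs.simple i, p.2 + if p.1 = cs.simple i then 1 else 0)

-- With r = s_i s_j one has s_j r^k = r^{-k} s_j, so the two sign tests of the n-th round become r^k
-- t = s_j for k = 2n and 2n + 1. When r^n = 1 the sum runs twice over the same terms and vanishes
-- mod 2; this gives the braid relations for the signed action.
open Classical in
theorem signedConj_mul_pow_apply (i j : I) (n : ℕ) (t : W) (ε : ZMod 2) :
    ((cs.signedConj i * cs.signedConj j) ^ n) (t, ε) =
      ((cs.simple i * cs.simple j) ^ n * t * ((cs.simple i * cs.simple j) ^ n)⁻¹,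
        ε + ∑ k ∈ Finset.range (2 * n),
          if (cs.simple i * cs.simple j) ^ k * t = cs.simple j then (1 : ZMod 2) else 0) := by
  set r := cs.simple i * cs.simple j with hr
  have hrj : ∀ k : ℕ, cs.simple j * r ^ k = (r ^ k)⁻¹ * cs.simple j := by
    intro k
    induction k with
    | zero => simp
    | succ k ih =>
      rw [pow_succ, ← mul_assoc, ih, mul_assoc, ← pow_succ, pow_succ', mul_inv_rev, mul_assoc]
      congr 1
      simp [hr, mul_assoc]
  have hconj : ∀ n a : ℕ, r ^ n * t * (r ^ n)⁻¹ = (r ^ a)⁻¹ * cs.simple j ↔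
      r ^ (2 * n + a) * t = cs.simple j := by
    intro n a
    rw [mul_inv_eq_iff_eq_mul, mul_assoc, hrj, ← mul_assoc, ← mul_inv_rev, ← pow_add,
      eq_inv_mul_iff_mul_eq, ← mul_assoc, ← pow_add, show n + a + n = 2 * n + a by ring]
  induction n with
  | zero => simp; rfl
  | succ n ih =>
    rw [pow_succ']
    change cs.signedConj i (cs.signedConj j (((cs.signedConj i * cs.signedConj j) ^ n) (t, ε))) = _
    rw [ih]
    simp only [signedConj, Prod.mk.injEq]
    refine ⟨?_, ?_⟩
    · rw [pow_succ' r n]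
      simp [hr, mul_assoc]
    · rw [show 2 * (n + 1) = 2 * n + 1 + 1 by ring, Finset.sum_range_succ, Finset.sum_range_succ]
      simp only [← add_assoc]
      congr 2
      · have := hconj n 0
        simp only [pow_zero, inv_one, one_mul, add_zero] at this
        simp only [this]
      · have h1 : cs.simple j * (r ^ n * t * (r ^ n)⁻¹) * cs.simple j = cs.simple i ↔
            r ^ n * t * (r ^ n)⁻¹ = (r ^ 1)⁻¹ * cs.simple j := by
          have h2 : (r ^ 1)⁻¹ * cs.simple j = cs.simple j * cs.simple i * cs.simple j := by
            simp [hr, mul_assoc]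
          rw [h2]
          constructor
          · intro h
            rw [← h]; simp [mul_assoc]
          · intro h
            rw [h]; simp [mul_assoc]
        simp only [h1, hconj]

theorem isLiftable_signedConj : M.IsLiftable cs.signedConj := by
  classical
  intro i j
  funext ⟨t, ε⟩
  rw [signedConj_mul_pow_apply, two_mul, Finset.sum_range_add]
  simp only [pow_add, cs.simple_mul_simple_pow, one_mul, CharTwo.add_self_eq_zero]
  simp; rfl

/-- The action of a Coxeter group on signed group elements. -/
noncomputable def signedConjHom : W →* Function.End (W × ZMod 2) :=
  cs.lift ⟨cs.signedConj, cs.isLiftable_signedConj⟩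

/-- The sign that `w` produces at `t`: the parity of the number of times that the wall of `t`
is crossed by a gallery of type a word for `w⁻¹`. -/
noncomputable def crossing (w t : W) : ZMod 2 := (cs.signedConjHom w (t, 0)).2

theorem signedConjHom_simple (i : I) : cs.signedConjHom (cs.simple i) = cs.signedConj i :=
  cs.lift_apply_simple cs.isLiftable_signedConj i

open Classical in
theorem signedConjHom_wordProd (ω : List I) (t : W) (ε : ZMod 2) :
    cs.signedConjHom (cs.wordProd ω) (t, ε) =
      (cs.wordProd ω * t * (cs.wordProd ω)⁻¹, ε + ((cs.rightInvSeq ω).count t : ZMod 2)) := by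
  induction ω with
  | nil => simp; rfl
  | cons i ω ih =>
    rw [wordProd_cons, map_mul]
    change cs.signedConjHom (cs.simple i) (cs.signedConjHom (cs.wordProd ω) (t, ε)) = _
    rw [ih, signedConjHom_simple]
    simp only [signedConj, Prod.mk.injEq, rightInvSeq, List.count_cons]
    refine ⟨by simp [mul_assoc], ?_⟩
    push_cast
    rw [add_assoc]
    congr 2
    rw [mul_inv_eq_iff_eq_mul]
    have : cs.wordProd ω * t = cs.simple i * cs.wordProd ω ↔
        (cs.wordProd ω)⁻¹ * cs.simple i * cs.wordProd ω = t := by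
      rw [mul_assoc, inv_mul_eq_iff_eq_mul, eq_comm]
    simp [this]

theorem signedConjHom_apply (w t : W) (ε : ZMod 2) :
    cs.signedConjHom w (t, ε) = (w * t * w⁻¹, ε + cs.crossing w t) := by
  classical
  obtain ⟨ω, rfl⟩ := cs.wordProd_surjective w
  simp [crossing, signedConjHom_wordProd]

open Classical in
theorem crossing_wordProd (ω : List I) (t : W) :
    cs.crossing (cs.wordProd ω) t = ((cs.rightInvSeq ω).count t : ZMod 2) := by
  simp [crossing, signedConjHom_wordProd]

theorem crossing_mul (u v t : W) :
    cs.crossing (u * v) t = cs.crossing v t + cs.crossing u (v * t * v⁻¹) := by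
  have h : cs.signedConjHom (u * v) (t, 0) = cs.signedConjHom u (cs.signedConjHom v (t, 0)) := by
    rw [map_mul]; rfl
  rw [signedConjHom_apply, signedConjHom_apply, signedConjHom_apply] at h
  simpa using congrArg Prod.snd h

theorem crossing_one (t : W) : cs.crossing 1 t = 0 := by
  simpa using cs.crossing_mul 1 1 t

theorem crossing_simple_self (i : I) : cs.crossing (cs.simple i) (cs.simple i) = 1 := by
  simp [crossing, signedConjHom_simple, signedConj]

/-- In the cocycle expansion of u s u⁻¹ the terms of u and u⁻¹ cancel, by the same rule applied to
u⁻¹u = 1; only the term of s remains. -/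
theorem IsReflection.crossing_self {cs : CoxeterSystem M W} {t : W} (ht : cs.IsReflection t) :
    cs.crossing t t = 1 := by
  obtain ⟨u, i, rfl⟩ := ht
  have h := cs.crossing_mul u⁻¹ u (cs.simple i)
  rw [inv_mul_cancel, crossing_one] at h
  rw [crossing_mul, crossing_mul]
  simp only [mul_assoc, inv_inv, inv_mul_cancel_left, inv_mul_cancel, mul_one,
    simple_mul_simple_self, inv_simple, one_mul] at h ⊢
  rw [crossing_simple_self, add_comm (1 : ZMod 2), ← add_assoc, add_comm (cs.crossing u⁻¹ _), ← h,
    zero_add]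

theorem mem_rightInvSeq_of_crossing {ω : List I} {t : W} (h : cs.crossing (cs.wordProd ω) t ≠ 0) :
    t ∈ cs.rightInvSeq ω := by
  classical
  rw [crossing_wordProd] at h
  by_contra hn
  exact h (by simp [List.count_eq_zero_of_not_mem hn])

theorem isRightInversion_of_crossing {w t : W} (h : cs.crossing w t ≠ 0) :
    cs.IsRightInversion w t := by
  obtain ⟨ω, hω, rfl⟩ := cs.exists_isReduced w
  exact cs.isRightInversion_of_mem_rightInvSeq hω (cs.mem_rightInvSeq_of_crossing h)

/-- If w had crossing number 0 at t, then wt would have 1, so t would be an inversion of wt; it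
cannot be one of both w and wt. -/
theorem IsReflection.isRightInversion_iff_crossing {cs : CoxeterSystem M W} {w t : W}
    (ht : cs.IsReflection t) : cs.IsRightInversion w t ↔ cs.crossing w t = 1 := by
  constructor
  · intro h
    by_contra hn
    have h0 : cs.crossing w t = 0 := by
      generalize cs.crossing w t = z at hn
      revert hn; revert z; decide
    refine ht.isRightInversion_mul_left_iff.1 (cs.isRightInversion_of_crossing ?_) h
    rw [crossing_mul, ht.crossing_self, ht.inv, ht.mul_self, one_mul, h0, add_zero]
    exact one_ne_zero
  · intro h
    exact cs.isRightInversion_of_crossing (by rw [h]; exact one_ne_zero)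

/-- The strong exchange condition. -/
theorem IsRightInversion.mem_rightInvSeq {cs : CoxeterSystem M W} {ω : List I} {t : W}
    (h : cs.IsRightInversion (cs.wordProd ω) t) : t ∈ cs.rightInvSeq ω :=
  cs.mem_rightInvSeq_of_crossing
    (by rw [h.1.isRightInversion_iff_crossing.1 h]; exact one_ne_zero)

theorem IsLeftInversion.mem_leftInvSeq {cs : CoxeterSystem M W} {ω : List I} {t : W}
    (h : cs.IsLeftInversion (cs.wordProd ω) t) : t ∈ cs.leftInvSeq ω := by
  rw [← isRightInversion_inv_iff, ← wordProd_reverse] at h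
  simpa [rightInvSeq_reverse] using h.mem_rightInvSeq

/-- The cocycle rule read mod 2: a wall separates the ends of a path iff exactly one of its two legs
crosses it. -/
theorem IsReflection.isRightInversion_mul {cs : CoxeterSystem M W} {t : W}
    (ht : cs.IsReflection t) (u v : W) :
    cs.IsRightInversion (u * v) t ↔
      ¬ (cs.IsRightInversion v t ↔ cs.IsRightInversion u (v * t * v⁻¹)) := by
  rw [ht.isRightInversion_iff_crossing, ht.isRightInversion_iff_crossing,
    (ht.conj v).isRightInversion_iff_crossing, crossing_mul]
  generalize cs.crossing v t = x
  generalize cs.crossing u _ = y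
  revert x y
  decide

theorem IsReflection.isLeftInversion_mul {cs : CoxeterSystem M W} {t : W}
    (ht : cs.IsReflection t) (u v : W) :
    cs.IsLeftInversion (u * v) t ↔
      ¬ (cs.IsLeftInversion u t ↔ cs.IsLeftInversion v (u⁻¹ * t * u)) := by
  simp only [← isRightInversion_inv_iff]
  rw [mul_inv_rev, ht.isRightInversion_mul, inv_inv]

theorem exists_eraseIdx_of_isRightDescent {ω : List I} {i : I}
    (h : cs.length (cs.wordProd ω * cs.simple i) < cs.length (cs.wordProd ω)) :
    ∃ j < ω.length, cs.wordProd ω * cs.simple i = cs.wordProd (ω.eraseIdx j) := by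
  have hm := IsRightInversion.mem_rightInvSeq (cs := cs) ⟨cs.isReflection_simple i, h⟩
  obtain ⟨j, hj, hji⟩ := List.mem_iff_getElem.mp hm
  refine ⟨j, by simpa using hj, ?_⟩
  rw [← wordProd_mul_getD_rightInvSeq, List.getD_eq_getElem _ 1 hj, hji]

/-- Letters are appended one at a time; a letter that shortens the product is dropped together with
the earlier letter found by exchange. That the result is a subword is what keeps reduced words of
W_J inside J. -/
theorem exists_isReduced_sublist (ω : List I) :
    ∃ ω' : List I, ω'.Sublist ω ∧ cs.IsReduced ω' ∧ cs.wordProd ω' = cs.wordProd ω := by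
  induction ω using List.reverseRecOn with
  | nil => exact ⟨[], List.Sublist.refl _, by simp [IsReduced], rfl⟩
  | append_singleton ω i ih =>
    obtain ⟨ω', hs, hr, hp⟩ := ih
    rcases cs.length_mul_simple (cs.wordProd ω') i with h | h
    · refine ⟨ω' ++ [i], hs.append (List.Sublist.refl _), ?_, ?_⟩
      · rw [IsReduced, wordProd_append, wordProd_singleton, h, hr.eq]; simp
      · rw [wordProd_append, wordProd_append, hp]
    · obtain ⟨j, hj, he⟩ := cs.exists_eraseIdx_of_isRightDescent (ω := ω') (i := i) (by omega)
      refine ⟨ω'.eraseIdx j, ((List.eraseIdx_sublist _ _).trans hs).trans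
        (List.sublist_append_left _ _), ?_, ?_⟩
      · have := List.length_eraseIdx_add_one hj
        have := hr.eq
        rw [IsReduced, ← he]; omega
      · rw [← he, wordProd_append, hp, wordProd_singleton]

end CoxeterSystem

/-! ### Parabolic subgroups and minimal coset representatives. -/

namespace WeylBuilding

open CoxeterSystem

variable {I W : Type*} [Group W] {M : CoxeterMatrix I} {cs : CoxeterSystem M W}

theorem wordProd_mem_parabolic {J : Set I} {ω : List I} (h : ∀ i ∈ ω, i ∈ J) :
    cs.wordProd ω ∈ parabolic cs J := by
  induction ω with
  | nil => simp
  | cons i ω ih =>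
    rw [wordProd_cons]
    exact mul_mem (Subgroup.subset_closure ⟨i, h i (by simp), rfl⟩)
      (ih fun j hj => h j (by simp [hj]))

theorem exists_isReduced_of_mem_parabolic {J : Set I} {w : W} (h : w ∈ parabolic cs J) :
    ∃ ω : List I, (∀ i ∈ ω, i ∈ J) ∧ cs.IsReduced ω ∧ cs.wordProd ω = w := by
  have h' : ∃ ω : List I, (∀ i ∈ ω, i ∈ J) ∧ cs.wordProd ω = w := by
    induction h using Subgroup.closure_induction with
    | mem x hx =>
      obtain ⟨i, hi, rfl⟩ := hx
      exact ⟨[i], by simpa using hi, by simp⟩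
    | one => exact ⟨[], by simp, by simp⟩
    | mul x y _ _ hx hy =>
      obtain ⟨ω, h1, rfl⟩ := hx
      obtain ⟨ω', h2, rfl⟩ := hy
      refine ⟨ω ++ ω', ?_, by rw [wordProd_append]⟩
      intro i hi
      rcases List.mem_append.1 hi with hi | hi
      exacts [h1 i hi, h2 i hi]
    | inv x _ hx =>
      obtain ⟨ω, h1, rfl⟩ := hx
      exact ⟨ω.reverse, by simpa using h1, by simp⟩
  obtain ⟨ω, hω, rfl⟩ := h'
  obtain ⟨ω', hs, hr, hp⟩ := cs.exists_isReduced_sublist ω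
  exact ⟨ω', fun i hi => hω i (hs.subset hi), hr, hp⟩

theorem mem_parabolic_singleton {i : I} {w : W} :
    w ∈ parabolic cs {i} ↔ w = 1 ∨ w = cs.simple i := by
  constructor
  · intro h
    obtain ⟨ω, h1, h2, rfl⟩ := exists_isReduced_of_mem_parabolic h
    match ω, h1, h2 with
    | [], _, _ => simp
    | [j], h1, _ =>
      have : j = i := by simpa using h1
      simp [this]
    | j :: k :: ω, h1, h2 =>
      have hj : j = i := by simpa using h1 j (by simp)
      have hk : k = i := by simpa using h1 k (by simp)
      subst hj hk
      have h3 := h2.take 2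
      simp [CoxeterSystem.IsReduced, wordProd_cons] at h3
  · rintro (rfl | rfl)
    · exact one_mem _
    · exact Subgroup.subset_closure ⟨i, rfl, rfl⟩

/-- `w` has minimal length in `w W_K`. -/
def IsRightMin (cs : CoxeterSystem M W) (K : Set I) (w : W) : Prop :=
  ∀ k ∈ parabolic cs K, cs.length w ≤ cs.length (w * k)

/-- `w` has minimal length in `W_J w`. -/
def IsLeftMin (cs : CoxeterSystem M W) (J : Set I) (w : W) : Prop :=
  ∀ k ∈ parabolic cs J, cs.length w ≤ cs.length (k * w)

theorem isRightMin_inv {K : Set I} {w : W} : IsRightMin cs K w⁻¹ ↔ IsLeftMin cs K w := by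
  constructor
  · intro h k hk
    simpa [← mul_inv_rev] using h k⁻¹ (inv_mem hk)
  · intro h k hk
    have := h k⁻¹ (inv_mem hk)
    rwa [← cs.length_inv w, ← cs.length_inv (k⁻¹ * w), mul_inv_rev, inv_inv] at this

/-- If a letter of a reduced word of k shortened the product, exchange would delete a letter of w,
giving a shorter element of w W_K, or a letter of k, against reducedness. -/
theorem IsRightMin.length_mul {K : Set I} {w k : W} (h : IsRightMin cs K w)
    (hk : k ∈ parabolic cs K) : cs.length (w * k) = cs.length w + cs.length k := by
  obtain ⟨κ, h1, h2, rfl⟩ := exists_isReduced_of_mem_parabolic hk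
  clear hk
  obtain ⟨ω, hω, rfl⟩ := cs.exists_isReduced w
  induction κ using List.reverseRecOn with
  | nil => simp
  | append_singleton κ i ih =>
    have hκ : cs.IsReduced κ := by simpa using h2.take κ.length
    have hK : ∀ j ∈ κ, j ∈ K := fun j hj => h1 j (by simp [hj])
    have ih := ih hK hκ
    rw [h2.eq, wordProd_append, wordProd_singleton, ← mul_assoc, List.length_append,
      List.length_singleton, ← add_assoc, ← hκ.eq, ← ih]
    rcases cs.length_mul_simple (cs.wordProd ω * cs.wordProd κ) i with h3 | h3
    · exact h3
    exfalso
    have h4 : cs.length (cs.wordProd (ω ++ κ) * cs.simple i) < cs.length (cs.wordProd (ω ++ κ)) := by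
      rw [wordProd_append]; omega
    obtain ⟨j, hj, he⟩ := cs.exists_eraseIdx_of_isRightDescent h4
    rw [wordProd_append] at he
    rcases lt_or_ge j ω.length with hlt | hge
    · rw [List.eraseIdx_append_of_lt_length hlt, wordProd_append] at he
      have h5 := h (cs.wordProd κ * cs.simple i * (cs.wordProd κ)⁻¹) (mul_mem (mul_mem
        (wordProd_mem_parabolic hK) (Subgroup.subset_closure ⟨i, h1 i (by simp), rfl⟩))
        (inv_mem (wordProd_mem_parabolic hK)))
      rw [← mul_assoc, ← mul_assoc, he, mul_inv_cancel_right, hω.eq] at h5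
      have := cs.length_wordProd_le (ω.eraseIdx j)
      have := List.length_eraseIdx_add_one hlt
      omega
    · rw [List.eraseIdx_append_of_length_le hge, wordProd_append, mul_assoc, mul_right_inj] at he
      have h6 := h2.eq
      rw [wordProd_append, wordProd_singleton, he, List.length_append, List.length_singleton] at h6
      have := cs.length_wordProd_le (κ.eraseIdx (j - ω.length))
      have := List.eraseIdx_sublist κ (j - ω.length) |>.length_le
      omega

theorem IsLeftMin.length_mul {J : Set I} {w k : W} (h : IsLeftMin cs J w)
    (hk : k ∈ parabolic cs J) : cs.length (k * w) = cs.length k + cs.length w := by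
  have := (isRightMin_inv.2 h).length_mul (inv_mem hk)
  rwa [← mul_inv_rev, cs.length_inv, cs.length_inv, cs.length_inv, add_comm] at this

/-- Double coset representatives that are reduced on both sides are unique. -/
theorem eq_of_isLeftMin_of_isRightMin {J K : Set I} {w w' a b : W}
    (hw : IsLeftMin cs J w) (hwK : IsRightMin cs K w) (hw' : IsLeftMin cs J w')
    (hwK' : IsRightMin cs K w') (ha : a ∈ parabolic cs J) (hb : b ∈ parabolic cs K)
    (h : a * w' = w * b) : w = w' := by
  obtain ⟨β, h1, h2, rfl⟩ := exists_isReduced_of_mem_parabolic hb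
  clear hb
  induction β using List.reverseRecOn generalizing a with
  | nil =>
    rw [wordProd_nil, mul_one] at h
    have h2 := hw'.length_mul ha
    have h3 : a⁻¹ * w = w' := by rw [← h, inv_mul_cancel_left]
    have h4 := hw.length_mul (inv_mem ha)
    rw [h] at h2
    rw [h3, cs.length_inv] at h4
    have : a = 1 := cs.length_eq_zero_iff.1 (by omega)
    rw [← h, this, one_mul]
  | append_singleton β i ih =>
    have hβ : ∀ j ∈ β, j ∈ K := fun j hj => h1 j (by simp [hj])
    have hi : i ∈ K := h1 i (by simp)
    have hβr : cs.IsReduced β := by simpa using h2.take β.length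
    obtain ⟨α, hα, -, rfl⟩ := exists_isReduced_of_mem_parabolic ha
    obtain ⟨ω, hω, rfl⟩ := cs.exists_isReduced w'
    have hs : cs.wordProd (α ++ ω) * cs.simple i = w * cs.wordProd β := by
      rw [wordProd_append, h, wordProd_append, wordProd_singleton, ← mul_assoc,
        simple_mul_simple_cancel_right]
    have hlt : cs.length (cs.wordProd (α ++ ω) * cs.simple i) <
        cs.length (cs.wordProd (α ++ ω)) := by
      rw [hs, wordProd_append, h, hwK.length_mul (wordProd_mem_parabolic hβ),
        hwK.length_mul (wordProd_mem_parabolic h1), hβr.eq, h2.eq]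
      simp
    -- A deletion in α only changes the W_J factor, so induction applies; one in ω would make w' s_i
    -- shorter than w'.
    obtain ⟨j, hj, he⟩ := cs.exists_eraseIdx_of_isRightDescent hlt
    rcases lt_or_ge j α.length with hjα | hjα
    · rw [hs, List.eraseIdx_append_of_lt_length hjα, wordProd_append] at he
      exact ih (wordProd_mem_parabolic fun k hk => hα k ((List.eraseIdx_sublist _ _).subset hk))
        hβ hβr he.symm
    · rw [List.eraseIdx_append_of_length_le hjα, wordProd_append, wordProd_append, mul_assoc,
        mul_right_inj] at he
      have h3 := hwK' (cs.simple i) (Subgroup.subset_closure ⟨i, hi, rfl⟩)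
      have := cs.length_wordProd_le (ω.eraseIdx (j - α.length))
      rw [List.length_append] at hj
      have := List.length_eraseIdx_add_one (l := ω) (i := j - α.length) (by omega)
      rw [he, hω.eq] at h3
      omega

theorem mem_parabolic_of_isLeftInversion {J : Set I} {u t : W} (hu : u ∈ parabolic cs J)
    (h : cs.IsLeftInversion u t) : t ∈ parabolic cs J := by
  obtain ⟨ω, h1, -, rfl⟩ := exists_isReduced_of_mem_parabolic hu
  have hm := h.mem_leftInvSeq
  clear h hu
  induction ω generalizing t with
  | nil => simp at hm
  | cons i ω ih =>
    have hi : cs.simple i ∈ parabolic cs J := Subgroup.subset_closure ⟨i, h1 i (by simp), rfl⟩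
    rw [leftInvSeq, List.mem_cons, List.mem_map] at hm
    rcases hm with rfl | ⟨r, hr, rfl⟩
    · exact hi
    · exact mul_mem (mul_mem hi (ih (fun j hj => h1 j (by simp [hj])) hr)) (inv_mem hi)

end WeylBuilding

/-! ### Galleries and the Weyl distance. -/

namespace WeylBuilding

open CoxeterSystem

variable {I W Δ : Type*} [Group W] {M : CoxeterMatrix I} {cs : CoxeterSystem M W}
  (X : WeylBuilding cs Δ)

theorem δ_self (x : Δ) : X.δ x x = 1 := (X.δ_eq_one_iff x x).2 rfl

theorem simple_ne_one (i : I) : cs.simple i ≠ 1 := by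
  intro h
  simpa [h] using cs.length_simple i

variable {X} in
theorem δ_symm_of_adj {x y : Δ} {i : I} (h : X.δ x y = cs.simple i) :
    X.δ y x = cs.simple i := by
  obtain ⟨z, hz, hxz⟩ := X.exists_adj x y i
  rw [h, simple_mul_simple_self, X.δ_eq_one_iff] at hxz
  rwa [hxz]

/-- There is a gallery from `x` to `y` of type `ω`. -/
def Gallery : Δ → List I → Δ → Prop
  | x, [], y => x = y
  | x, i :: ω, y => ∃ z, X.δ x z = cs.simple i ∧ Gallery z ω y

variable {X}

theorem gallery_append {x y : Δ} {ω ω' : List I} :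
    X.Gallery x (ω ++ ω') y ↔ ∃ z, X.Gallery x ω z ∧ X.Gallery z ω' y := by
  induction ω generalizing x with
  | nil => simp [Gallery]
  | cons i ω ih =>
    simp only [List.cons_append, Gallery, ih]
    constructor
    · rintro ⟨z, hz, u, hu, hu'⟩
      exact ⟨u, ⟨z, hz, hu⟩, hu'⟩
    · rintro ⟨u, ⟨z, hz, hu⟩, hu'⟩
      exact ⟨z, hz, u, hu, hu'⟩

theorem gallery_singleton {x y : Δ} {i : I} : X.Gallery x [i] y ↔ X.δ x y = cs.simple i := by
  simp [Gallery]

theorem Gallery.reverse {x y : Δ} {ω : List I} (h : X.Gallery x ω y) :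
    X.Gallery y ω.reverse x := by
  induction ω generalizing x with
  | nil => exact Eq.symm h
  | cons i ω ih =>
    obtain ⟨z, hz, h⟩ := h
    rw [List.reverse_cons, gallery_append]
    exact ⟨z, ih h, gallery_singleton.2 (δ_symm_of_adj hz)⟩

/-- Every prefix of a reduced word is reduced, so each step lengthens the distance and the building
axiom for lengthening steps applies. -/
theorem Gallery.δ_eq {x y : Δ} {ω : List I} (h : X.Gallery x ω y) (hω : cs.IsReduced ω) :
    X.δ x y = cs.wordProd ω := by
  induction ω using List.reverseRecOn generalizing y with
  | nil =>
    have : x = y := h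
    rw [this, δ_self, wordProd_nil]
  | append_singleton ω i ih =>
    obtain ⟨z, hz, hi⟩ := gallery_append.1 h
    have hr : cs.IsReduced ω := by simpa using hω.take ω.length
    have h1 := ih hz hr
    rw [wordProd_append, wordProd_singleton, ← h1]
    refine X.δ_adj_of_length _ _ _ _ (gallery_singleton.1 hi) ?_
    have := hω.eq
    rw [wordProd_append, wordProd_singleton] at this
    rw [h1, this, hr.eq]
    simp

theorem gallery_of_δ_eq {x y : Δ} {ω : List I} (h : X.δ x y = cs.wordProd ω) :
    X.Gallery x ω y := by
  induction ω using List.reverseRecOn generalizing y with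
  | nil => exact (X.δ_eq_one_iff x y).1 (by simpa using h)
  | append_singleton ω i ih =>
    obtain ⟨z, hz, hxz⟩ := X.exists_adj x y i
    rw [gallery_append]
    refine ⟨z, ih ?_, gallery_singleton.2 (δ_symm_of_adj hz)⟩
    rw [hxz, h, wordProd_append, wordProd_singleton, simple_mul_simple_cancel_right]

theorem δ_inv (x y : Δ) : (X.δ x y)⁻¹ = X.δ y x := by
  obtain ⟨ω, hω, h⟩ := cs.exists_isReduced (X.δ x y)
  rw [(gallery_of_δ_eq h).reverse.δ_eq hω.reverse, wordProd_reverse, h]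

theorem δ_mul {x y z : Δ}
    (h : cs.length (X.δ x y * X.δ y z) = cs.length (X.δ x y) + cs.length (X.δ y z)) :
    X.δ x z = X.δ x y * X.δ y z := by
  obtain ⟨ω, hω, h1⟩ := cs.exists_isReduced (X.δ x y)
  obtain ⟨ω', hω', h2⟩ := cs.exists_isReduced (X.δ y z)
  rw [h1, h2, ← wordProd_append, hω.eq, hω'.eq, ← List.length_append] at h
  rw [(gallery_append.2 ⟨y, gallery_of_δ_eq h1, gallery_of_δ_eq h2⟩).δ_eq h, wordProd_append,
    h1, h2]

theorem exists_δ_eq_δ_eq {x y : Δ} {u v : W} (h : X.δ x y = u * v) :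
    ∃ z, X.δ x z = u ∧ X.δ z y = v := by
  obtain ⟨ω, hω, rfl⟩ := cs.exists_isReduced u
  obtain ⟨ω', hω', rfl⟩ := cs.exists_isReduced v
  rw [← wordProd_append] at h
  obtain ⟨z, h1, h2⟩ := gallery_append.1 (gallery_of_δ_eq h)
  exact ⟨z, h1.δ_eq hω, h2.δ_eq hω'⟩

/-- Seen from x, each step of the gallery either multiplies the distance by its letter or leaves it
unchanged. -/
theorem Gallery.exists_sublist {x y z : Δ} {ω : List I} (h : X.Gallery y ω z) :
    ∃ ω' : List I, ω'.Sublist ω ∧ X.δ x z = X.δ x y * cs.wordProd ω' := by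
  induction ω using List.reverseRecOn generalizing z with
  | nil =>
    have : y = z := h
    exact ⟨[], List.Sublist.refl _, by simp [this]⟩
  | append_singleton ω i ih =>
    obtain ⟨u, hu, hi⟩ := gallery_append.1 h
    obtain ⟨ω', hs, he⟩ := ih hu
    rcases X.δ_adj x u z i (gallery_singleton.1 hi) with h1 | h1
    · refine ⟨ω' ++ [i], hs.append (List.Sublist.refl _), ?_⟩
      rw [h1, he, wordProd_append, wordProd_singleton, mul_assoc]
    · exact ⟨ω', hs.trans (List.sublist_append_left _ _), by rw [h1, he]⟩

theorem exists_δ_eq_mul (x y z : Δ) :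
    ∃ u, cs.length u ≤ cs.length (X.δ y z) ∧ X.δ x z = X.δ x y * u := by
  obtain ⟨ω, hω, h⟩ := cs.exists_isReduced (X.δ y z)
  obtain ⟨ω', hs, he⟩ := (gallery_of_δ_eq h).exists_sublist (x := x)
  refine ⟨_, ?_, he⟩
  rw [h, hω.eq]
  exact (cs.length_wordProd_le _).trans hs.length_le

theorem exists_mem_parabolic_δ_eq_mul {J : Set I} {y z : Δ} (h : X.δ y z ∈ parabolic cs J)
    (x : Δ) : ∃ u ∈ parabolic cs J, X.δ x z = X.δ x y * u := by
  obtain ⟨ω, hJ, -, h⟩ := exists_isReduced_of_mem_parabolic h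
  obtain ⟨ω', hs, he⟩ := (gallery_of_δ_eq h.symm).exists_sublist (x := x)
  exact ⟨_, wordProd_mem_parabolic fun i hi => hJ i (hs.subset hi), he⟩

theorem mem_residue_self (J : Set I) (x : Δ) : x ∈ X.residue J x := by
  change X.δ x x ∈ parabolic cs J
  rw [δ_self]
  exact one_mem _

theorem δ_mem_parabolic_trans {J : Set I} {x y z : Δ} (h : X.δ x y ∈ parabolic cs J)
    (h' : X.δ y z ∈ parabolic cs J) : X.δ x z ∈ parabolic cs J := by
  obtain ⟨u, hu, he⟩ := exists_mem_parabolic_δ_eq_mul h' x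
  rw [he]
  exact mul_mem h hu

theorem δ_mem_parabolic_comm {J : Set I} {x y : Δ} (h : X.δ x y ∈ parabolic cs J) :
    X.δ y x ∈ parabolic cs J := by
  rw [← δ_inv]
  exact inv_mem h

theorem residue_eq_of_mem {J : Set I} {x y : Δ} (h : y ∈ X.residue J x) :
    X.residue J y = X.residue J x := by
  ext z
  exact ⟨fun hz => δ_mem_parabolic_trans h hz,
    fun hz => δ_mem_parabolic_trans (δ_mem_parabolic_comm h) hz⟩

end WeylBuilding

/-! ### Extending isometries to apartments. -/

namespace WeylBuilding

open CoxeterSystem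

variable {I W Δ : Type*} [Group W] {M : CoxeterMatrix I} {cs : CoxeterSystem M W}
  {X : WeylBuilding cs Δ}

variable (X) in
/-- `S` is the graph of a `δ`-isometry from a subset of `W` to the building. -/
def IsIsometricGraph (S : Set (W × Δ)) : Prop :=
  ∀ p ∈ S, ∀ q ∈ S, X.δ p.2 q.2 = p.1⁻¹ * q.1

/-- Otherwise δ(d,e') = y', and moving from e to e' multiplies δ(d,e) by y⁻¹ s y'. Both y and y' lie
beyond the wall of s, so this element is longer than δ(e,e') = y⁻¹ y', which is impossible. -/
theorem δ_eq_of_folded {c d e e' : Δ} {i : I} {y y' : W} (hcd : X.δ c d = cs.simple i)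
    (hde : X.δ d e = cs.simple i * y)
    (hy : cs.length (cs.simple i * y) < cs.length y) (hce' : X.δ c e' = y')
    (hy' : cs.length (cs.simple i * y') < cs.length y') (hee' : X.δ e e' = y⁻¹ * y') :
    X.δ d e' = cs.simple i * y' := by
  have hi := cs.isReflection_simple i
  rcases X.δ_adj e' c d i hcd with h | h
  · rw [← δ_inv, h, mul_inv_rev, δ_inv, hce', inv_simple]
  · exfalso
    have h1 : X.δ d e' = y' := by rw [← δ_inv, h, δ_inv, hce']
    obtain ⟨u, hu, hu'⟩ := exists_δ_eq_mul d e e' (X := X)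
    have h2 : u = y⁻¹ * cs.simple i * y * (y⁻¹ * y') := by
      rw [h1, hde] at hu'
      rw [hu']
      simp [mul_assoc]
    have ht : cs.IsReflection (y⁻¹ * cs.simple i * y) := by simpa using hi.conj y⁻¹
    have h3 := hi.isLeftInversion_mul y (y⁻¹ * y')
    rw [mul_inv_cancel_left] at h3
    have h4 : ¬ cs.IsLeftInversion (y⁻¹ * y') (y⁻¹ * cs.simple i * y) := by
      have h5 : cs.IsLeftInversion y (cs.simple i) := ⟨hi, hy⟩
      have h6 : cs.IsLeftInversion y' (cs.simple i) := ⟨hi, hy'⟩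
      tauto
    have h5 := ht.length_mul_right_ne (y⁻¹ * y')
    have h6 : ¬ cs.length (y⁻¹ * cs.simple i * y * (y⁻¹ * y')) < cs.length (y⁻¹ * y') :=
      fun h => h4 ⟨ht, h⟩
    rw [hee', h2] at hu
    omega

/-- If some point (w, e) of the graph lies beyond the wall between x and x s_i, then d is taken on a
minimal gallery from c to e: `δ_eq_of_folded` handles the points beyond the wall, additivity of
lengths the others. If there is none, any s_i-neighbour of c works. -/
theorem IsIsometricGraph.exists_insert {S : Set (W × Δ)} (hS : X.IsIsometricGraph S) {x : W}
    {c : Δ} (hx : (x, c) ∈ S) (i : I) :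
    ∃ d, X.IsIsometricGraph (insert (x * cs.simple i, d) S) := by
  suffices h : ∃ d, ∀ q ∈ S, X.δ d q.2 = (x * cs.simple i)⁻¹ * q.1 by
    obtain ⟨d, hd⟩ := h
    refine ⟨d, ?_⟩
    rintro p (rfl | hp) q (rfl | hq)
    · simp [δ_self]
    · exact hd q hq
    · rw [← δ_inv, hd p hp]; simp
    · exact hS p hp q hq
  have hmul : ∀ d, X.δ c d = cs.simple i → ∀ q ∈ S,
      ¬ cs.length (cs.simple i * (x⁻¹ * q.1)) < cs.length (x⁻¹ * q.1) →
      X.δ d q.2 = (x * cs.simple i)⁻¹ * q.1 := by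
    intro d hd q hq hl
    have h1 := hS _ hx _ hq
    dsimp only at h1
    have h2 := δ_symm_of_adj hd
    rw [mul_inv_rev, inv_simple, mul_assoc, ← h1, ← h2]
    refine δ_mul ?_
    rw [h2, h1, length_simple]
    have := cs.length_simple_mul (x⁻¹ * q.1) i
    omega
  by_cases hex : ∃ q ∈ S, cs.length (cs.simple i * (x⁻¹ * q.1)) < cs.length (x⁻¹ * q.1)
  · obtain ⟨⟨w, e⟩, hq, hl⟩ := hex
    have h1 := hS _ hx _ hq
    dsimp only at h1 hl
    obtain ⟨d, hd, hde⟩ := exists_δ_eq_δ_eq (X := X) (x := c) (y := e) (u := cs.simple i)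
      (v := cs.simple i * (x⁻¹ * w)) (by rw [h1]; simp)
    refine ⟨d, fun q hq' => ?_⟩
    by_cases hl' : cs.length (cs.simple i * (x⁻¹ * q.1)) < cs.length (x⁻¹ * q.1)
    · rw [mul_inv_rev, inv_simple, mul_assoc]
      refine δ_eq_of_folded hd hde hl (hS _ hx _ hq') hl' ?_
      rw [hS _ hq _ hq']
      simp [mul_assoc]
    · exact hmul d hd q hq' hl'
  · obtain ⟨d, hd, -⟩ := X.exists_adj c c i
    exact ⟨d, fun q hq => hmul d hd q hq fun h => hex ⟨q, hq, h⟩⟩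

/-- A `δ`-isometry from a nonempty subset of `W` extends to `W`. -/
theorem IsIsometricGraph.exists_chart {S : Set (W × Δ)} (hS : X.IsIsometricGraph S)
    (hne : S.Nonempty) :
    ∃ f : W → Δ, X.IsChart (Set.range f) f ∧ ∀ p ∈ S, f p.1 = p.2 := by
  obtain ⟨T, hST, hT⟩ := zorn_subset_nonempty {S | X.IsIsometricGraph S} (by
    intro C hC hch _
    refine ⟨⋃₀ C, ?_, fun s hs => Set.subset_sUnion_of_mem hs⟩
    rintro p ⟨s, hs, hp⟩ q ⟨t, ht, hq⟩
    rcases hch.total hs ht with h | h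
    · exact hC ht p (h hp) q hq
    · exact hC hs p hp q (h hq)) S hS
  have hTi : X.IsIsometricGraph T := hT.prop
  obtain ⟨⟨x, c⟩, hx⟩ := hne
  have hall : ∀ w : W, ∃ d, (x * w, d) ∈ T := by
    intro w
    induction w using cs.simple_induction_right with
    | one => exact ⟨c, by simpa using hST hx⟩
    | mul_simple_right w i ih =>
      obtain ⟨d, hd⟩ := ih
      obtain ⟨d', hd'⟩ := hTi.exists_insert hd i
      refine ⟨d', ?_⟩
      rw [← mul_assoc]
      -- By maximality the inserted pair already belongs to T, so the domain of T is closed under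
      -- right multiplication by simple reflections.
      exact hT.le_of_ge hd' (Set.subset_insert _ _) (Set.mem_insert _ _)
  have hall' : ∀ w : W, ∃ d, (w, d) ∈ T := fun w => by simpa using hall (x⁻¹ * w)
  choose f hf using hall'
  refine ⟨f, ⟨fun u v => hTi _ (hf u) _ (hf v), rfl⟩, fun p hp => ?_⟩
  rw [← X.δ_eq_one_iff, hTi _ (hf p.1) _ (hST hp), inv_mul_cancel]

theorem exists_isApartment (c d : Δ) : ∃ A, X.IsApartment A ∧ c ∈ A ∧ d ∈ A := by
  have hS : X.IsIsometricGraph {((1 : W), c), (X.δ c d, d)} := by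
    rintro p (rfl | rfl) q (rfl | rfl)
    · simp [δ_self]
    · simp
    · simp [δ_inv]
    · simp [δ_self]
  obtain ⟨f, hf, h⟩ := hS.exists_chart (Set.insert_nonempty _ _)
  refine ⟨_, ⟨f, hf⟩, ⟨1, h (1, c) ?_⟩, ⟨X.δ c d, h (X.δ c d, d) ?_⟩⟩ <;> simp

end WeylBuilding

/-! ### Projections between residues. -/

namespace WeylBuilding

open CoxeterSystem

variable {I W Δ : Type*} [Group W] {M : CoxeterMatrix I} {cs : CoxeterSystem M W}
  {X : WeylBuilding cs Δ}

theorem exists_δ_eq_mul_of_mem_parabolic {J : Set I} {k : W} (hk : k ∈ parabolic cs J)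
    (x y : Δ) : ∃ z ∈ X.residue J y, X.δ x z = X.δ x y * k := by
  obtain ⟨ω, hJ, -, rfl⟩ := exists_isReduced_of_mem_parabolic hk
  clear hk
  induction ω using List.reverseRecOn with
  | nil => exact ⟨y, mem_residue_self J y, by simp⟩
  | append_singleton ω i ih =>
    obtain ⟨z, hz, hxz⟩ := ih fun j hj => hJ j (by simp [hj])
    obtain ⟨u, hu, hxu⟩ := X.exists_adj x z i
    refine ⟨u, δ_mem_parabolic_trans hz ?_, ?_⟩
    · rw [hu]
      exact Subgroup.subset_closure ⟨i, hJ i (by simp), rfl⟩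
    · rw [hxu, hxz, wordProd_append, wordProd_singleton, mul_assoc]

theorem δ_mul_of_isRightMin {J : Set I} {x y z : Δ} (h : IsRightMin cs J (X.δ x y))
    (hz : X.δ y z ∈ parabolic cs J) : X.δ x z = X.δ x y * X.δ y z :=
  δ_mul (h.length_mul hz)

theorem δ_mul_of_isLeftMin {J : Set I} {x y z : Δ} (h : IsLeftMin cs J (X.δ y z))
    (hz : X.δ x y ∈ parabolic cs J) : X.δ x z = X.δ x y * X.δ y z :=
  δ_mul (h.length_mul hz)

theorem isRightMin_δ_comm {J : Set I} {x y : Δ} :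
    IsRightMin cs J (X.δ x y) ↔ IsLeftMin cs J (X.δ y x) := by
  rw [← δ_inv, isRightMin_inv]

theorem eq_of_isRightMin {J : Set I} {x y z : Δ} (hy : IsRightMin cs J (X.δ x y))
    (hz : IsRightMin cs J (X.δ x z)) (hyz : X.δ y z ∈ parabolic cs J) : y = z := by
  have h1 := hy.length_mul hyz
  have h2 := hz (X.δ y z)⁻¹ (inv_mem hyz)
  rw [δ_mul_of_isRightMin hy hyz, mul_inv_cancel_right, h1] at h2
  rw [← X.δ_eq_one_iff, ← cs.length_eq_zero_iff]
  omega

namespace Simplex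

theorem exists_type (a : X.Simplex) : ∃ J, ∀ x ∈ a.res, a.res = X.residue J x := by
  obtain ⟨J, -, x, h⟩ := a.isSpherical
  refine ⟨J, fun y hy => ?_⟩
  rw [h] at hy ⊢
  exact (residue_eq_of_mem hy).symm

end Simplex

section Projection

variable {a b : X.Simplex} {J K : Set I}

theorem proj_mem (b : X.Simplex) (x : Δ) : X.proj b x ∈ b.res :=
  Function.argminOn_mem _ _ _

theorem isRightMin_δ_proj (hb : ∀ x ∈ b.res, b.res = X.residue J x) (x : Δ) :
    IsRightMin cs J (X.δ x (X.proj b x)) := by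
  intro k hk
  obtain ⟨z, hz, he⟩ := exists_δ_eq_mul_of_mem_parabolic hk x (X.proj b x)
  rw [← he]
  rw [← hb _ (proj_mem b x)] at hz
  exact Function.argminOn_le (fun y => cs.length (X.δ x y)) _ hz

theorem proj_eq (hb : ∀ x ∈ b.res, b.res = X.residue J x) {x y : Δ} (hy : y ∈ b.res)
    (h : IsRightMin cs J (X.δ x y)) : X.proj b x = y := by
  refine (eq_of_isRightMin h (isRightMin_δ_proj hb x) ?_).symm
  have := proj_mem b x
  rwa [hb y hy] at this

/-- If c' is the projection of e and d' that of c' back to 𝓐, then δ(c',d') is minimal on both sides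
and lies in the double coset of δ(c,d), so the two agree. Conversely, left minimality makes c' the
projection of d'. -/
theorem projRes_eq (hb : ∀ x ∈ b.res, b.res = X.residue J x)
    (ha : ∀ x ∈ a.res, a.res = X.residue K x) {c d : Δ} (hc : c ∈ b.res) (hd : d ∈ a.res)
    (hJ : IsLeftMin cs J (X.δ c d)) (hK : IsRightMin cs K (X.δ c d)) :
    X.projRes b a = {c' | c' ∈ b.res ∧ ∃ d' ∈ a.res, X.δ c' d' = X.δ c d} := by
  ext c'
  constructor
  · rintro ⟨e, he, rfl⟩
    have hc' := proj_mem b e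
    have hL := isRightMin_δ_comm.1 (isRightMin_δ_proj hb e)
    generalize X.proj b e = c' at hc' hL
    refine ⟨hc', X.proj a c', proj_mem _ _, ?_⟩
    have hd' := proj_mem a c'
    have hR := isRightMin_δ_proj ha c'
    generalize X.proj a c' = d' at hd' hR
    have hde : X.δ d' e ∈ parabolic cs K := by rwa [ha d' hd'] at he
    have hL' : IsLeftMin cs J (X.δ c' d') := by
      intro k hk
      have h1 := hL k hk
      rw [δ_mul_of_isRightMin hR hde, hR.length_mul hde, ← mul_assoc] at h1
      have := cs.length_mul_le (k * X.δ c' d') (X.δ d' e)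
      omega
    have hcc' : X.δ c c' ∈ parabolic cs J := by rwa [hb c hc] at hc'
    have hdd' : X.δ d d' ∈ parabolic cs K := by rwa [ha d hd] at hd'
    refine (eq_of_isLeftMin_of_isRightMin hJ hK hL' hR hcc' hdd' ?_).symm
    rw [← δ_mul_of_isLeftMin hL' hcc', ← δ_mul_of_isRightMin hK hdd']
  · rintro ⟨hc', d', hd', h⟩
    refine ⟨d', hd', proj_eq hb hc' ?_⟩
    rwa [isRightMin_δ_comm, h]

/-- This description involves only the distances from c, so every type-preserving map fixing c
preserves the set. -/
theorem projRes_eq_of_conj (hb : ∀ x ∈ b.res, b.res = X.residue J x)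
    (ha : ∀ x ∈ a.res, a.res = X.residue K x) {c d : Δ} (hc : c ∈ b.res) (hd : d ∈ a.res)
    (hJ : IsLeftMin cs J (X.δ c d)) (hK : IsRightMin cs K (X.δ c d)) :
    X.projRes b a = {c' | X.δ c c' ∈ parabolic cs J ∧
      (X.δ c d)⁻¹ * X.δ c c' * X.δ c d ∈ parabolic cs K} := by
  rw [projRes_eq hb ha hc hd hJ hK]
  ext c'
  constructor
  · rintro ⟨hc', d', hd', h⟩
    have hcc' : X.δ c c' ∈ parabolic cs J := by rwa [hb c hc] at hc'
    have hdd' : X.δ d d' ∈ parabolic cs K := by rwa [ha d hd] at hd'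
    refine ⟨hcc', ?_⟩
    have h1 := δ_mul_of_isLeftMin (X := X) (x := c) (y := c') (z := d') (by rwa [h]) hcc'
    rw [δ_mul_of_isRightMin hK hdd', h] at h1
    rwa [mul_assoc, ← h1, inv_mul_cancel_left]
  · rintro ⟨hcc', hk⟩
    refine ⟨by rw [hb c hc]; exact hcc', ?_⟩
    have h1 := δ_mul_of_isLeftMin hJ (δ_mem_parabolic_comm hcc')
    rw [← δ_inv c c'] at h1
    -- Here δ(c',d) = δ(c,c')⁻¹ w is rewritten as w times an element of W_K, so that d' stays in the
    -- residue of d.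
    obtain ⟨d', h2, h3⟩ := exists_δ_eq_δ_eq (X := X) (x := c') (y := d) (u := X.δ c d)
      (v := ((X.δ c d)⁻¹ * X.δ c c' * X.δ c d)⁻¹) (by rw [h1]; simp [mul_assoc])
    refine ⟨d', ?_, h2⟩
    rw [ha d hd]
    exact δ_mem_parabolic_comm (by rw [h3]; exact inv_mem hk)

end Projection

theorem IsChart.exists_closest {A : Set Δ} {f : W → Δ} (hf : X.IsChart A f) {a b : X.Simplex}
    {J K : Set I} (hb : ∀ x ∈ b.res, b.res = X.residue J x)
    (ha : ∀ x ∈ a.res, a.res = X.residue K x) (hbA : b.LiesIn A) (haA : a.LiesIn A) :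
    ∃ x y, f x ∈ b.res ∧ f y ∈ a.res ∧ IsLeftMin cs J (x⁻¹ * y) ∧ IsRightMin cs K (x⁻¹ * y) := by
  obtain ⟨hδ, rfl⟩ := hf
  obtain ⟨_, hx, x, rfl⟩ := hbA
  obtain ⟨_, hy, y, rfl⟩ := haA
  have hne : {p : W × W | f p.1 ∈ b.res ∧ f p.2 ∈ a.res}.Nonempty := ⟨(x, y), hx, hy⟩
  clear hx hy x y
  obtain ⟨p, hmem, hle⟩ : ∃ p : W × W, (f p.1 ∈ b.res ∧ f p.2 ∈ a.res) ∧
      ∀ q : W × W, f q.1 ∈ b.res ∧ f q.2 ∈ a.res →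
        cs.length (p.1⁻¹ * p.2) ≤ cs.length (q.1⁻¹ * q.2) :=
    ⟨_, Function.argminOn_mem (fun p : W × W => cs.length (p.1⁻¹ * p.2)) _ hne,
      fun q hq => Function.argminOn_le (fun p : W × W => cs.length (p.1⁻¹ * p.2)) _ hq⟩
  obtain ⟨x, y⟩ := p
  obtain ⟨hx, hy⟩ := hmem
  dsimp only at hx hy hle
  refine ⟨x, y, hx, hy, fun k hk => ?_, fun k hk => ?_⟩
  · have := hle (x * k⁻¹, y) ⟨?_, hy⟩
    · simpa [mul_assoc] using this
    · rw [hb _ hx]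
      change X.δ (f x) (f (x * k⁻¹)) ∈ parabolic cs J
      rw [hδ, inv_mul_cancel_left]
      exact inv_mem hk
  · have := hle (x, y * k) ⟨hx, ?_⟩
    · simpa [mul_assoc] using this
    · rw [ha _ hy]
      change X.δ (f y) (f (y * k)) ∈ parabolic cs K
      rwa [hδ, inv_mul_cancel_left]

end WeylBuilding

/-! ### Orbits and stabilizers. -/

open Cardinal in
/-- If the stabilizer of `a` is contained in that of `b`, then the orbit of `a` is fibred over the
orbit of `b`. -/
theorem MulAction.mk_orbit_eq_mul {G : Type*} {α β : Type uΔ} [Group G] [MulAction G α]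
    [MulAction G β] {a : α} {b : β} (h : stabilizer G a ≤ stabilizer G b) :
    #(orbit G a) = #(orbit G b) * #{a' : α | ∃ g : G, g • a = a' ∧ g • b = b} := by
  rw [mul_def]
  have hσ : ∀ y : orbit G b, ∃ g : G, g • b = y := fun y => y.2
  -- The elements σ y carry the fibre over b to the fibre over y.
  choose σ hσ using hσ
  refine (mk_congr (Equiv.ofBijective (fun p : orbit G b × {a' : α | ∃ g : G, g • a = a' ∧
    g • b = b} => (⟨σ p.1 • p.2.1, ?_⟩ : orbit G a)) ⟨?_, ?_⟩)).symm
  · obtain ⟨_, _, g, rfl, -⟩ := p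
    exact ⟨σ _ * g, mul_smul _ _ _⟩
  · rintro ⟨y, _, g, rfl, hg⟩ ⟨y', _, g', rfl, hg'⟩ he
    have he : σ y • g • a = σ y' • g' • a := congrArg Subtype.val he
    have h1 : (σ y * g)⁻¹ * (σ y' * g') ∈ stabilizer G a := by
      rw [mem_stabilizer_iff, mul_smul, mul_smul (σ y'), ← he, ← mul_smul, ← mul_smul]
      simp
    have h2 := h h1
    rw [mem_stabilizer_iff, mul_smul, inv_smul_eq_iff, mul_smul, mul_smul, hg, hg', hσ, hσ] at h2
    obtain rfl : y' = y := Subtype.ext h2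
    have h3 := MulAction.injective (σ y') he
    exact Prod.ext rfl (Subtype.ext h3)
  · rintro ⟨_, g, rfl⟩
    refine ⟨⟨⟨g • b, g, rfl⟩, (σ ⟨g • b, g, rfl⟩)⁻¹ • g • a, (σ ⟨g • b, g, rfl⟩)⁻¹ * g,
      mul_smul _ _ _, ?_⟩, Subtype.ext (smul_inv_smul _ _)⟩
    rw [mul_smul, inv_smul_eq_iff, hσ]

namespace WeylBuilding

open CoxeterSystem

section

variable {I W : Type*} {Δ : Type*} {G : Type*} [Group W] {M : CoxeterMatrix I}
  {cs : CoxeterSystem M W} {X : WeylBuilding cs Δ} [Group G] [MulAction G Δ]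
  {a b : X.Simplex} {J K : Set I}

theorem IsTypePreserving.smul_residue (hG : X.IsTypePreserving G) (J : Set I) (g : G) (x : Δ) :
    g • X.residue J x = X.residue J (g • x) := by
  ext y
  rw [Set.mem_smul_set_iff_inv_smul_mem]
  change X.δ x (g⁻¹ • y) ∈ parabolic cs J ↔ X.δ (g • x) y ∈ parabolic cs J
  rw [← hG g, smul_inv_smul]

theorem IsTypePreserving.smul_res_eq (hG : X.IsTypePreserving G)
    (hb : ∀ x ∈ b.res, b.res = X.residue J x) {g : G} {x : Δ} (hx : x ∈ b.res)
    (hgx : g • x ∈ b.res) : g • b.res = b.res := by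
  conv_lhs => rw [hb x hx]
  rw [hG.smul_residue, ← hb _ hgx]

theorem smul_mem_of_mem_stab {g : G} (hg : g ∈ b.stab G) {x : Δ} :
    g • x ∈ b.res ↔ x ∈ b.res := by
  have h : g • b.res = b.res := hg
  conv_lhs => rw [← h]
  exact Set.smul_mem_smul_set_iff

theorem smul_projRes (hG : X.IsTypePreserving G) {g : G} (hg : g ∈ b.stab G)
    (hga : g ∈ a.stab G) : g • X.projRes b a = X.projRes b a := by
  obtain ⟨J, hb⟩ := b.exists_type
  have h : g • a.res = a.res := hga
  have hp : ∀ x, X.proj b (g • x) = g • X.proj b x := by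
    intro x
    refine proj_eq hb ((smul_mem_of_mem_stab hg).2 (proj_mem b x)) ?_
    rw [hG]
    exact isRightMin_δ_proj hb x
  conv_rhs => rw [projRes, ← h]
  rw [projRes, ← Set.image_smul, ← Set.image_smul, Set.image_image, Set.image_image]
  simp only [hp]

theorem smul_projRes_of_fix (hG : X.IsTypePreserving G)
    (hb : ∀ x ∈ b.res, b.res = X.residue J x)
    (ha : ∀ x ∈ a.res, a.res = X.residue K x) {c d : Δ} (hc : c ∈ b.res) (hd : d ∈ a.res)
    (hJ : IsLeftMin cs J (X.δ c d)) (hK : IsRightMin cs K (X.δ c d)) {g : G} (hg : g • c = c) :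
    g • X.projRes b a = X.projRes b a := by
  ext x
  rw [Set.mem_smul_set_iff_inv_smul_mem, projRes_eq_of_conj hb ha hc hd hJ hK]
  have : X.δ c (g⁻¹ • x) = X.δ c x := by rw [← hG g, smul_inv_smul, hg]
  simp only [Set.mem_ofPred_eq, this]

/-- The stabilizer of a simplex acts transitively on its residue. -/
theorem exists_mem_stab_smul_eq (hG : X.IsTypePreserving G) (hW : X.IsWeylTransitive G)
    {c c' : Δ} (hc : c ∈ b.res) (hc' : c' ∈ b.res) : ∃ g ∈ b.stab G, g • c = c' := by
  obtain ⟨J, hb⟩ := b.exists_type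
  obtain ⟨g, hg, -⟩ := hW c c c' c' (by rw [δ_self, δ_self])
  exact ⟨g, hG.smul_res_eq hb hc (by rwa [hg]), hg⟩

theorem projRes_subset : X.projRes b a ⊆ b.res := by
  rintro _ ⟨x, -, rfl⟩
  exact proj_mem b x

open Cardinal in
theorem mk_orbit_projRes_eq_one_iff (hG : X.IsTypePreserving G) (hW : X.IsWeylTransitive G) :
    #(MulAction.orbit (b.stab G) (X.projRes b a)) = 1 ↔ X.IsAlignedPair b a := by
  rw [IsAlignedPair, eq_one_iff_unique]
  constructor
  · rintro ⟨hs, -⟩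
    refine projRes_subset.antisymm fun x hx => ?_
    obtain ⟨d, hd⟩ := a.res_nonempty
    have hp : X.proj b d ∈ X.projRes b a := ⟨d, hd, rfl⟩
    obtain ⟨g, hg, rfl⟩ := exists_mem_stab_smul_eq hG hW (projRes_subset hp) hx
    have h1 : g • X.projRes b a = X.projRes b a := congrArg Subtype.val
      (hs.elim ⟨g • X.projRes b a, ⟨g, hg⟩, rfl⟩ ⟨X.projRes b a, 1, one_smul _ _⟩)
    rw [← h1]
    exact Set.smul_mem_smul_set hp
  · intro h
    refine ⟨⟨?_⟩, ⟨⟨_, MulAction.mem_orbit_self _⟩⟩⟩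
    rintro ⟨_, g, rfl⟩ ⟨_, g', rfl⟩
    have h1 : ∀ g : b.stab G, g • X.projRes b a = b.res := fun g => by rw [h]; exact g.2
    exact Subtype.ext ((h1 g).trans (h1 g').symm)

end

variable {I W : Type*} {Δ : Type uΔ} {G : Type uG} [Group W] {M : CoxeterMatrix I}
  {cs : CoxeterSystem M W} {X : WeylBuilding cs Δ} [Group G] [MulAction G Δ]
  {a b : X.Simplex} {J K : Set I}

open Cardinal

/-- The fibre is parametrized by sending d' to its K-residue. Injectivity is uniqueness of the
projection of c; for surjectivity, g⁻¹c is still in proj_𝓑(𝓐), so some chamber of 𝓐 is at distance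
δ(c,d) from it, and g carries that chamber to the required d'. -/
theorem mk_orbit_res_eq (hG : X.IsTypePreserving G) (hW : X.IsWeylTransitive G)
    (hb : ∀ x ∈ b.res, b.res = X.residue J x)
    (ha : ∀ x ∈ a.res, a.res = X.residue K x) {c d : Δ} (hc : c ∈ b.res) (hd : d ∈ a.res)
    (hJ : IsLeftMin cs J (X.δ c d)) (hK : IsRightMin cs K (X.δ c d)) :
    #(MulAction.orbit (b.stab G) a.res) =
      #(MulAction.orbit (b.stab G) (X.projRes b a)) * #{d' | X.δ c d' = X.δ c d} := by
  rw [MulAction.mk_orbit_eq_mul (G := b.stab G) (a := a.res) (b := X.projRes b a)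
    fun g hg => smul_projRes hG g.2 hg]
  congr 1
  refine (mk_congr (Equiv.ofBijective (fun d' : {d' | X.δ c d' = X.δ c d} =>
    (⟨X.residue K d'.1, ?_⟩ : {A' : Set Δ | ∃ g : b.stab G, g • a.res = A' ∧
      g • X.projRes b a = X.projRes b a})) ⟨?_, ?_⟩)).symm
  · obtain ⟨g, hgc, hgd⟩ := hW c d c d' d'.2.symm
    refine ⟨⟨g, hG.smul_res_eq hb hc (by rwa [hgc])⟩, ?_,
      smul_projRes_of_fix hG hb ha hc hd hJ hK hgc⟩
    change g • a.res = _
    rw [ha d hd, hG.smul_residue, hgd]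
  · rintro ⟨d₁, h₁⟩ ⟨d₂, h₂⟩ he
    have he : X.residue K d₁ = X.residue K d₂ := congrArg Subtype.val he
    have hm : d₂ ∈ X.residue K d₁ := by rw [he]; exact mem_residue_self K d₂
    rw [Set.mem_ofPred_eq] at h₁ h₂
    exact Subtype.ext (eq_of_isRightMin (by rwa [h₁]) (by rwa [h₂]) hm)
  · rintro ⟨_, g, rfl, hg⟩
    have hcR : c ∈ X.projRes b a := by
      rw [projRes_eq hb ha hc hd hJ hK]
      exact ⟨hc, d, hd, rfl⟩
    have h1 : (g : G)⁻¹ • c ∈ X.projRes b a := by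
      rw [← Set.mem_smul_set_iff_inv_smul_mem]
      exact hg.symm ▸ hcR
    rw [projRes_eq hb ha hc hd hJ hK] at h1
    obtain ⟨-, d', hd', h2⟩ := h1
    refine ⟨⟨(g : G) • d', ?_⟩, Subtype.ext ?_⟩
    · rw [Set.mem_ofPred_eq, ← h2, ← hG (g : G) ((g : G)⁻¹ • c), smul_inv_smul]
    · change X.residue K ((g : G) • d') = (g : G) • a.res
      rw [ha d' hd', hG.smul_residue]

theorem lift_mk_quotient_stab :
    lift.{uΔ} #(b.stab G ⧸ (b.stab G ⊓ a.stab G).subgroupOf (b.stab G)) =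
      lift.{uG} #(MulAction.orbit (b.stab G) a.res) := by
  have h : (b.stab G ⊓ a.stab G).subgroupOf (b.stab G) =
      MulAction.stabilizer (b.stab G) a.res := by
    ext g
    rw [Subgroup.mem_subgroupOf, Subgroup.mem_inf]
    exact ⟨fun h => h.2, fun h => ⟨g.2, h⟩⟩
  rw [h]
  exact lift_mk_eq'.2 ⟨(MulAction.orbitEquivQuotientStabilizer _ _).symm⟩

end WeylBuilding

/-! ### Walls, thickness and the size of spheres. -/

namespace WeylBuilding

open CoxeterSystem Cardinal

section

variable {I W : Type*} {Δ : Type*} [Group W] {M : CoxeterMatrix I}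
  {cs : CoxeterSystem M W} {X : WeylBuilding cs Δ} {f : W → Δ}
  {a b : X.Simplex} {J K : Set I}

theorem isRightMin_singleton {i : I} {w : W}
    (h : cs.length (w * cs.simple i) = cs.length w + 1) : IsRightMin cs {i} w := by
  intro k hk
  rcases mem_parabolic_singleton.1 hk with rfl | rfl
  · rw [mul_one]
  · omega

theorem exists_δ_eq (x : Δ) (w : W) : ∃ y, X.δ x y = w := by
  obtain ⟨y, -, hy⟩ := exists_δ_eq_mul_of_mem_parabolic (X := X) (cs := cs) (J := Set.univ)
    (k := w) (by rw [parabolic, Set.image_univ, cs.subgroup_closure_range_simple]; trivial) x x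
  exact ⟨y, by rw [hy, δ_self, one_mul]⟩

theorem eq_of_adj {x z p q : Δ} {i : I} (hp : X.δ z p = cs.simple i) (hq : X.δ z q = cs.simple i)
    (h : X.δ x p = X.δ x q)
    (hl : cs.length (X.δ x p * cs.simple i) = cs.length (X.δ x p) + 1) : p = q := by
  have hs : cs.simple i ∈ parabolic cs {i} := mem_parabolic_singleton.2 (Or.inr rfl)
  refine eq_of_isRightMin (J := {i}) (isRightMin_singleton hl)
    (isRightMin_singleton (by rwa [← h])) (δ_mem_parabolic_trans (δ_mem_parabolic_comm (y := p)
      (x := z) (by rwa [hp])) (by rwa [hq]))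

/-- Since δ(p,d) = s_i v = v s_j, each p is carried along v to some p' that is s_j-adjacent to d.
The map is injective because p is the chamber nearest to p' in the s_i-panel of c. -/
theorem mk_adj_le_of_conj {v : W} {i j : I} (h : cs.simple i * v = v * cs.simple j)
    (hl : cs.length (cs.simple i * v) = cs.length v + 1) {c d : Δ} (hcd : X.δ c d = v) :
    #{p | X.δ c p = cs.simple i} ≤ #{p | X.δ d p = cs.simple j} := by
  have hex : ∀ p : {p | X.δ c p = cs.simple i}, ∃ p', X.δ p.1 p' = v ∧
      X.δ d p' = cs.simple j := by
    rintro ⟨p, hp⟩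
    have hp' := δ_symm_of_adj hp
    have h1 : X.δ p d = v * cs.simple j := by
      rw [← h, ← hp', ← hcd]
      refine δ_mul ?_
      rw [hp', hcd, hl, length_simple, add_comm]
    obtain ⟨p', h2, h3⟩ := exists_δ_eq_δ_eq h1
    exact ⟨p', h2, δ_symm_of_adj h3⟩
  choose φ hφ hφ' using hex
  refine mk_le_of_injective (f := fun p => (⟨φ p, hφ' p⟩ : {p | X.δ d p = cs.simple j})) ?_
  intro p q he
  have he : φ p = φ q := congrArg Subtype.val he
  have hp : X.δ (φ p) p.1 = v⁻¹ := by rw [← δ_inv, hφ]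
  have hq : X.δ (φ p) q.1 = v⁻¹ := by rw [he, ← δ_inv, hφ]
  refine Subtype.ext (eq_of_adj p.2 q.2 (hp.trans hq.symm) ?_)
  rw [hp, ← cs.length_inv, mul_inv_rev, inv_inv, inv_simple, hl, cs.length_inv]

theorem panelThickness_eq {p : X.Simplex} {i : I} {x : Δ} (h : p.res = X.residue {i} x) :
    ∃ y ∈ p.res, p.panelThickness = #{z | X.δ y z = cs.simple i} := by
  have hy := p.res_nonempty.some_mem
  refine ⟨_, hy, ?_⟩
  rw [Simplex.panelThickness]
  generalize p.res_nonempty.some = y at hy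
  have : p.res \ {y} = {z | X.δ y z = cs.simple i} := by
    rw [h] at hy ⊢
    rw [← residue_eq_of_mem hy]
    ext z
    constructor
    · rintro ⟨h1, h2⟩
      exact (mem_parabolic_singleton.1 h1).resolve_left
        fun h3 => h2 ((X.δ_eq_one_iff _ _).1 h3).symm
    · intro h1
      refine ⟨mem_parabolic_singleton.2 (Or.inr h1), ?_⟩
      rintro rfl
      exact simple_ne_one i (h1.symm.trans (δ_self X z))
  rw [this]

variable (X) in
/-- The simplex whose residue is the `{i}`-residue of `x`. -/
def panel (i : I) (x : Δ) : X.Simplex where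
  res := X.residue {i} x
  isSpherical := ⟨{i}, Set.Finite.subset (Set.toFinite {1, cs.simple i})
    fun _ h => mem_parabolic_singleton.1 h, x, rfl⟩

theorem isReflection_ne_one {t : W} (ht : cs.IsReflection t) : t ≠ 1 := by
  rintro rfl
  simpa using ht.odd_length

theorem panel_mem_reflectionWall {A : Set Δ} (hf : X.IsChart A f) (u : W) (i : I) :
    X.panel i (f u) ∈ X.reflectionWall f (u * cs.simple i * u⁻¹) := by
  refine ⟨⟨f u, mem_residue_self _ _, u, rfl⟩, fun w hw => ?_⟩
  have hw : X.δ (f u) (f w) ∈ parabolic cs {i} := hw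
  change X.δ (f u) (f _) ∈ parabolic cs {i}
  rw [hf.1] at hw ⊢
  have : u⁻¹ * (u * cs.simple i * u⁻¹ * w) = cs.simple i * (u⁻¹ * w) := by simp [mul_assoc]
  rw [this]
  exact mul_mem (mem_parabolic_singleton.2 (Or.inr rfl)) hw

theorem eq_conj_of_mem_reflectionWall {A : Set Δ} (hf : X.IsChart A f) {t : W}
    (ht : cs.IsReflection t) {p : X.Simplex} (hp : p ∈ X.reflectionWall f t) {i : I} {w : W}
    (h : p.res = X.residue {i} (f w)) : t = w * cs.simple i * w⁻¹ := by
  have h1 := hp.2 w (by rw [h]; exact mem_residue_self _ _)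
  rw [h] at h1
  have h1 : X.δ (f w) (f (t * w)) ∈ parabolic cs {i} := h1
  rw [hf.1] at h1
  rcases mem_parabolic_singleton.1 h1 with h2 | h2
  · refine absurd ?_ (isReflection_ne_one ht)
    exact mul_eq_right.1 (inv_mul_eq_one.1 h2).symm
  · rw [← h2]; simp [mul_assoc]

theorem reflectionWall_injOn {A : Set Δ} (hf : X.IsChart A f) {t t' : W}
    (ht : cs.IsReflection t) (ht' : cs.IsReflection t')
    (h : X.reflectionWall f t = X.reflectionWall f t') : t = t' := by
  obtain ⟨u, i, rfl⟩ := ht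
  have h1 := panel_mem_reflectionWall hf u i
  rw [h] at h1
  exact (eq_conj_of_mem_reflectionWall hf ht' h1 rfl).symm

/-- A simplex lies in a closed halfspace as soon as one of its chambers does, so separation means
that all chambers of one simplex are opposite to all chambers of the other. -/
theorem separates_iff {f : W → Δ} {t : W} (ht : cs.IsReflection t) {x y : X.Simplex} :
    (¬ (x ∈ X.halfspace f (positiveSide cs t) ∧ y ∈ X.halfspace f (positiveSide cs t)) ∧
      ¬ (x ∈ X.halfspace f (positiveSide cs t)ᶜ ∧ y ∈ X.halfspace f (positiveSide cs t)ᶜ)) ↔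
    ∀ u v, f u ∈ x.res → f v ∈ y.res → cs.IsLeftInversion (u⁻¹ * v) (u⁻¹ * t * u) := by
  have hpos : ∀ w, w ∈ (positiveSide cs t)ᶜ ↔ cs.IsLeftInversion w t := by
    intro w
    have := ht.length_mul_right_ne w
    change ¬ cs.length w < cs.length (t * w) ↔ cs.IsReflection t ∧ cs.length (t * w) < cs.length w
    simp only [ht, true_and]
    omega
  have hsep : ∀ u v, cs.IsLeftInversion (u⁻¹ * v) (u⁻¹ * t * u) ↔
      ¬ (u ∈ positiveSide cs t ↔ v ∈ positiveSide cs t) := by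
    intro u v
    have h1 := ht.isLeftInversion_mul u (u⁻¹ * v)
    rw [mul_inv_cancel_left, ← hpos, ← hpos] at h1
    simp only [Set.mem_compl_iff] at h1
    tauto
  constructor
  · rintro ⟨h1, h2⟩ u v hu hv
    rw [hsep]
    intro h3
    by_cases h : u ∈ positiveSide cs t
    · exact h1 ⟨⟨u, h, hu⟩, ⟨v, h3.1 h, hv⟩⟩
    · exact h2 ⟨⟨u, h, hu⟩, ⟨v, fun h4 => h (h3.2 h4), hv⟩⟩
  · intro h
    constructor
    · rintro ⟨⟨u, hu, hu'⟩, ⟨v, hv, hv'⟩⟩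
      exact (hsep u v).1 (h u v hu' hv') (iff_of_true hu hv)
    · rintro ⟨⟨u, hu, hu'⟩, ⟨v, hv, hv'⟩⟩
      exact (hsep u v).1 (h u v hu' hv') (iff_of_false hu hv)

theorem IsChart.exists_eq_mul {A : Set Δ} {f f' : W → Δ} (hf : X.IsChart A f)
    (hf' : X.IsChart A f') : ∃ g, ∀ w, f' w = f (g * w) := by
  have h : ∀ w, ∃ v, f v = f' w := fun w => by
    have : f' w ∈ A := hf'.2 ▸ ⟨w, rfl⟩
    rwa [← hf.2] at this
  obtain ⟨g, hg⟩ := h 1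
  refine ⟨g, fun w => ?_⟩
  obtain ⟨v, hv⟩ := h w
  have h1 := hf'.1 1 w
  rw [← hg, ← hv, hf.1, inv_one, one_mul] at h1
  rw [← hv, ← h1, mul_inv_cancel_left]

/-- Two charts of an apartment differ by a left translation, which merely conjugates the
reflections; one fixed chart therefore suffices. -/
theorem mem_separatingWalls_iff {A : Set Δ} (hf : X.IsChart A f) {x y : X.Simplex}
    {m : Set X.Simplex} : m ∈ X.separatingWalls A x y ↔
      ∃ t, cs.IsReflection t ∧ m = X.reflectionWall f t ∧ ∀ u v, f u ∈ x.res → f v ∈ y.res →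
        cs.IsLeftInversion (u⁻¹ * v) (u⁻¹ * t * u) := by
  constructor
  · rintro ⟨f', t, hf', ht, rfl, hs⟩
    obtain ⟨g, hg⟩ := hf.exists_eq_mul hf'
    rw [separates_iff ht] at hs
    refine ⟨g * t * g⁻¹, ht.conj g, ?_, fun u v hu hv => ?_⟩
    · ext p
      refine and_congr (by rw [hf.2, hf'.2]) ⟨fun h w hw => ?_, fun h w hw => ?_⟩
      · have := h (g⁻¹ * w) (by rwa [hg, mul_inv_cancel_left])
        rw [hg] at this
        simpa [mul_assoc] using this
      · have := h (g * w) (by rwa [← hg])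
        rw [hg]
        simpa [mul_assoc] using this
    · have := hs (g⁻¹ * u) (g⁻¹ * v) (by rwa [hg, mul_inv_cancel_left])
        (by rwa [hg, mul_inv_cancel_left])
      simpa [mul_assoc] using this
  · rintro ⟨t, ht, rfl, hs⟩
    exact ⟨f, t, hf, ht, rfl, (separates_iff ht).2 hs⟩

/-- A wall between the closest chambers is not crossed inside either residue: its reflection would
then lie in W_J or W_K, up to translation, and shorten the minimal x⁻¹y. So it separates every pair
of chambers of the two residues. -/
theorem mem_separatingWalls_iff_of_closest {A : Set Δ} (hf : X.IsChart A f)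
    (hb : ∀ x ∈ b.res, b.res = X.residue J x)
    (ha : ∀ x ∈ a.res, a.res = X.residue K x) {x y : W} (hx : f x ∈ b.res) (hy : f y ∈ a.res)
    (hJ : IsLeftMin cs J (x⁻¹ * y)) (hK : IsRightMin cs K (x⁻¹ * y)) {m : Set X.Simplex} :
    m ∈ X.separatingWalls A b a ↔
      ∃ r, cs.IsLeftInversion (x⁻¹ * y) r ∧ m = X.reflectionWall f (x * r * x⁻¹) := by
  rw [mem_separatingWalls_iff hf]
  constructor
  · rintro ⟨t, ht, rfl, h⟩
    exact ⟨_, h x y hx hy, by simp [mul_assoc]⟩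
  · rintro ⟨r, hr, rfl⟩
    have ht := hr.1.conj x
    refine ⟨_, ht, rfl, fun u v hu hv => ?_⟩
    have hrx : x⁻¹ * (x * r * x⁻¹) * x = r := by simp [mul_assoc]
    have hry : x⁻¹ * y * (y⁻¹ * (x * r * x⁻¹) * y) = r * (x⁻¹ * y) := by simp [mul_assoc]
    generalize x * r * x⁻¹ = t at ht hrx hry ⊢
    have hxu : x⁻¹ * u ∈ parabolic cs J := by
      rw [hb _ hx] at hu
      rw [← hf.1]
      exact hu
    have hyv : y⁻¹ * v ∈ parabolic cs K := by
      rw [ha _ hy] at hv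
      rw [← hf.1]
      exact hv
    have h1 := ht.isLeftInversion_mul u (u⁻¹ * v)
    have h2 := ht.isLeftInversion_mul x (x⁻¹ * y)
    have h3 := ht.isLeftInversion_mul x (x⁻¹ * u)
    have h4 := ht.isLeftInversion_mul y (y⁻¹ * v)
    rw [mul_inv_cancel_left] at h1 h2 h3 h4
    rw [hrx] at h2 h3
    have h5 : ¬ cs.IsLeftInversion (x⁻¹ * u) r := fun h =>
      (hJ r (mem_parabolic_of_isLeftInversion hxu h)).not_gt hr.2
    have h6 : ¬ cs.IsLeftInversion (y⁻¹ * v) (y⁻¹ * t * y) := fun h => by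
      have h7 := hK _ (mem_parabolic_of_isLeftInversion hyv h)
      rw [hry] at h7
      exact h7.not_gt hr.2
    tauto

end

variable {I W : Type*} {Δ : Type uΔ} {G : Type uG} [Group W] {M : CoxeterMatrix I}
  {cs : CoxeterSystem M W} {X : WeylBuilding cs Δ} [Group G] [MulAction G Δ]
  {a b : X.Simplex} {J K : Set I} {f : W → Δ}

theorem mk_adj_eq (hG : X.IsTypePreserving G) (hW : X.IsWeylTransitive G) (i : I) (x y : Δ) :
    #{z | X.δ x z = cs.simple i} = #{z | X.δ y z = cs.simple i} := by
  obtain ⟨g, rfl, -⟩ := hW x x y y (by rw [δ_self, δ_self])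
  refine mk_congr ((MulAction.toPerm g).subtypeEquiv fun z => ?_)
  change X.δ x z = _ ↔ X.δ (g • x) (g • z) = _
  rw [hG]

/-- The element v = u⁻¹w satisfies s_i v = v s_j, and so does s_i v; the shorter of the two makes
`mk_adj_le_of_conj` applicable in both directions. -/
theorem mk_adj_eq_of_conj (hG : X.IsTypePreserving G) (hW : X.IsWeylTransitive G) {i j : I}
    {u w : W} (h : u * cs.simple i * u⁻¹ = w * cs.simple j * w⁻¹) (x : Δ) :
    #{z | X.δ x z = cs.simple i} = #{z | X.δ x z = cs.simple j} := by
  have key : ∀ v : W, cs.simple i * v = v * cs.simple j →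
      cs.length (cs.simple i * v) = cs.length v + 1 →
      #{z | X.δ x z = cs.simple i} = #{z | X.δ x z = cs.simple j} := by
    intro v hv hl
    obtain ⟨y, hy⟩ := exists_δ_eq (X := X) x v
    rw [mk_adj_eq hG hW j x y]
    refine (mk_adj_le_of_conj hv hl hy).antisymm (mk_adj_le_of_conj (v := v⁻¹) ?_ ?_ ?_)
    · rw [eq_inv_mul_iff_mul_eq, ← mul_assoc, mul_inv_eq_iff_eq_mul, hv]
    · rw [← cs.length_inv, mul_inv_rev, inv_inv, inv_simple, ← hv, hl, cs.length_inv]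
    · rw [← δ_inv, hy]
  have hv : cs.simple i * (u⁻¹ * w) = u⁻¹ * w * cs.simple j := by
    rw [mul_assoc, eq_inv_mul_iff_mul_eq]
    simpa [mul_assoc] using congrArg (· * w) h
  rcases cs.length_simple_mul (u⁻¹ * w) i with hl | hl
  · exact key _ hv hl
  · refine key (cs.simple i * (u⁻¹ * w)) ?_ ?_
    · rw [mul_assoc (cs.simple i) _ (cs.simple j), hv]
    · rw [simple_mul_simple_cancel_left, hl]

/-- Independence of the chosen panel: its type is a simple reflection conjugate to s_i, since both
panels determine the same reflection. -/
theorem wallThickness_reflectionWall (hG : X.IsTypePreserving G) (hW : X.IsWeylTransitive G)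
    {A : Set Δ} (hf : X.IsChart A f) (u : W) (i : I) (x : Δ) :
    X.wallThickness (X.reflectionWall f (u * cs.simple i * u⁻¹)) =
      #{z | X.δ x z = cs.simple i} := by
  have h : ∃ p ∈ X.reflectionWall f (u * cs.simple i * u⁻¹), p.IsPanel :=
    ⟨_, panel_mem_reflectionWall hf u i, i, f u, rfl⟩
  rw [wallThickness, dif_pos h]
  obtain ⟨hp, j, y, hy⟩ := h.choose_spec
  generalize h.choose = p at hp hy
  obtain ⟨_, hw, w, rfl⟩ := hp.1
  rw [hy] at hw
  have hres := hy.trans (residue_eq_of_mem hw).symm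
  have ht := eq_conj_of_mem_reflectionWall hf ((cs.isReflection_simple i).conj u) hp hres
  obtain ⟨z, -, hz⟩ := panelThickness_eq hy
  rw [hz, mk_adj_eq hG hW j z x, mk_adj_eq_of_conj hG hW ht x]

/-- The penultimate chamber z is determined by y, being the one nearest to x in the panel. -/
theorem mk_sphere_mul_simple (hG : X.IsTypePreserving G) (hW : X.IsWeylTransitive G) {w : W}
    {i : I} (hl : cs.length (w * cs.simple i) = cs.length w + 1) (x : Δ) :
    #{y | X.δ x y = w * cs.simple i} = #{y | X.δ x y = w} * #{y | X.δ x y = cs.simple i} := by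
  rw [← sum_const', ← funext (fun z : {y | X.δ x y = w} => mk_adj_eq hG hW i z.1 x), ← mk_sigma]
  refine (mk_congr (Equiv.ofBijective (fun p : Σ z : {y | X.δ x y = w},
    {y | X.δ z.1 y = cs.simple i} => (⟨p.2.1, ?_⟩ : {y | X.δ x y = w * cs.simple i}))
    ⟨?_, ?_⟩)).symm
  · obtain ⟨⟨z, rfl⟩, y, hy⟩ := p
    exact X.δ_adj_of_length _ _ _ _ hy hl
  · rintro ⟨⟨z, hz⟩, y, hy⟩ ⟨⟨z', hz'⟩, y', hy'⟩ he
    obtain rfl : y = y' := congrArg Subtype.val he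
    obtain rfl : z = z' := eq_of_adj (X := X) (δ_symm_of_adj hy) (δ_symm_of_adj hy')
      (Eq.trans hz (Eq.symm hz')) (by rw [show X.δ x z = w from hz, hl])
    rfl
  · rintro ⟨y, hy⟩
    obtain ⟨z, hz, hzy⟩ := exists_δ_eq_δ_eq hy
    exact ⟨⟨⟨z, hz⟩, y, hzy⟩, rfl⟩

theorem mk_sphere_wordProd (hG : X.IsTypePreserving G) (hW : X.IsWeylTransitive G) {ω : List I}
    (hω : cs.IsReduced ω) (x : Δ) :
    #{y | X.δ x y = cs.wordProd ω} = (ω.map fun i => #{y | X.δ x y = cs.simple i}).prod := by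
  induction ω using List.reverseRecOn with
  | nil =>
    rw [List.map_nil, List.prod_nil, eq_one_iff_unique]
    refine ⟨⟨fun y z => Subtype.ext ?_⟩, ⟨⟨x, by simp [δ_self]⟩⟩⟩
    obtain ⟨y, hy⟩ := y
    obtain ⟨z, hz⟩ := z
    exact ((X.δ_eq_one_iff x y).1 (by simpa using hy)).symm.trans
      ((X.δ_eq_one_iff x z).1 (by simpa using hz))
  | append_singleton ω i ih =>
    have hr : cs.IsReduced ω := by simpa using hω.take ω.length
    have h := hω.eq
    rw [wordProd_append, wordProd_singleton, List.length_append, List.length_singleton,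
      ← hr.eq] at h
    rw [wordProd_append, wordProd_singleton, mk_sphere_mul_simple hG hW h, ih hr]
    simp

theorem pairThickness_eq_mk_sphere (hG : X.IsTypePreserving G) (hW : X.IsWeylTransitive G)
    {A : Set Δ} (hf : X.IsChart A f)
    (hb : ∀ x ∈ b.res, b.res = X.residue J x)
    (ha : ∀ x ∈ a.res, a.res = X.residue K x) {x y : W} (hx : f x ∈ b.res) (hy : f y ∈ a.res)
    (hJ : IsLeftMin cs J (x⁻¹ * y)) (hK : IsRightMin cs K (x⁻¹ * y)) (c : Δ) :
    X.pairThickness A b a = #{d | X.δ c d = x⁻¹ * y} := by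
  have hm := fun m => mem_separatingWalls_iff_of_closest hf hb ha hx hy hJ hK (m := m)
  obtain ⟨ω, hω, hxy⟩ := cs.exists_isReduced (x⁻¹ * y)
  rw [hxy] at hm ⊢
  have hlen := cs.length_leftInvSeq ω
  let r : Fin ω.length → W := fun k => (cs.leftInvSeq ω)[k.1]
  have hr : ∀ k, cs.IsLeftInversion (cs.wordProd ω) (r k) := fun k =>
    cs.isLeftInversion_of_mem_leftInvSeq hω (List.getElem_mem _)
  -- The inversions of a reduced word are distinct, and strong exchange shows that they exhaust the
  -- inversions of w.
  let e : Fin ω.length ≃ X.separatingWalls A b a := Equiv.ofBijective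
    (fun k => ⟨X.reflectionWall f (x * r k * x⁻¹), (hm _).2 ⟨_, hr k, rfl⟩⟩) (by
      constructor
      · intro k l h
        have h1 := reflectionWall_injOn hf ((hr k).1.conj x) ((hr l).1.conj x)
          (congrArg Subtype.val h)
        rw [mul_left_inj, mul_right_inj] at h1
        exact Fin.ext ((hω.nodup_leftInvSeq.getElem_inj_iff).1 h1)
      · rintro ⟨m, h⟩
        obtain ⟨t, ht, rfl⟩ := (hm m).1 h
        obtain ⟨k, hk, rfl⟩ := List.mem_iff_getElem.1 ht.mem_leftInvSeq
        exact ⟨⟨k, by omega⟩, rfl⟩)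
  let : Fintype (X.separatingWalls A b a) := Fintype.ofEquiv _ e
  rw [pairThickness, prod_eq_of_fintype, lift_id, ← e.prod_comp, mk_sphere_wordProd hG hW hω,
    ← Fin.prod_univ_fun_getElem]
  refine Finset.prod_congr rfl fun k _ => ?_
  change X.wallThickness (X.reflectionWall f (x * (cs.leftInvSeq ω)[k.1] * x⁻¹)) = _
  -- The k-th inversion is the k-th letter conjugated by the preceding prefix, so its wall has the
  -- thickness of that letter.
  rw [getElem_leftInvSeq cs ω k.1 k.2, ← wallThickness_reflectionWall hG hW hf
    (x * cs.wordProd (ω.take k)) _ c]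
  simp [mul_assoc]

end WeylBuilding

theorem mainTheorem5 {I : Type uI} {W : Type uW} [Group W] {M : CoxeterMatrix I}
    {cs : CoxeterSystem M W} {Δ : Type uΔ} (X : WeylBuilding cs Δ)
    {G : Type uG} [Group G] [MulAction G Δ]
    (hG : X.IsTypePreserving G) (hW : X.IsWeylTransitive G) (a b : X.Simplex) :
    (∃ A : Set Δ, X.IsApartment A ∧ b.LiesIn A ∧ a.LiesIn A) ∧
    (∀ A : Set Δ, X.IsApartment A → b.LiesIn A → a.LiesIn A →
      Cardinal.lift.{uΔ} (Cardinal.mk (b.stab G ⧸ (b.stab G ⊓ a.stab G).subgroupOf (b.stab G))) =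
        Cardinal.lift.{uG}
          (Cardinal.mk (MulAction.orbit (b.stab G) (X.projRes b a)) * X.pairThickness A b a)) ∧
    (Cardinal.mk (MulAction.orbit (b.stab G) (X.projRes b a)) = 1 ↔ X.IsAlignedPair b a) := by
  refine ⟨?_, ?_, WeylBuilding.mk_orbit_projRes_eq_one_iff hG hW⟩
  · obtain ⟨c, hc⟩ := b.res_nonempty
    obtain ⟨d, hd⟩ := a.res_nonempty
    obtain ⟨A, hA, hcA, hdA⟩ := WeylBuilding.exists_isApartment (X := X) c d
    exact ⟨A, hA, ⟨c, hc, hcA⟩, ⟨d, hd, hdA⟩⟩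
  · rintro A ⟨f, hf⟩ hbA haA
    obtain ⟨J, hb⟩ := b.exists_type
    obtain ⟨K, ha⟩ := a.exists_type
    obtain ⟨x, y, hx, hy, hJ, hK⟩ := hf.exists_closest hb ha hbA haA
    rw [WeylBuilding.lift_mk_quotient_stab,
      WeylBuilding.pairThickness_eq_mk_sphere hG hW hf hb ha hx hy hJ hK (f x)]
    rw [← hf.1] at hJ hK ⊢
    rw [WeylBuilding.mk_orbit_res_eq hG hW hb ha hx hy hJ hK]
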